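/- **Setting.** An *abstract spherical polyhedron* is a finite $3$-connected planar graph on a vertex set $V$ drawn on the sphere, with its faces. A *block and hole polyhedron* $\mathcal P$ is one whose faces are partitioned into blocks, holes and triangular surface faces; the *swapped* polyhedron $\overline{\mathcal P}$ has blocks and holes interchanged. Let $p$ place the vertices in real projective $3$-space, adjacent vertices at distinct points, in *block and hole general position*: no block and no hole has all its vertices on one line. Let $a\vee b\in\mathbb R^6$ be the Plücker vector of the line through the points $a,b$ (in homogeneous coordinates). **Static framework.** $G_S(\mathcal P,p)$ is the bar and joint framework whose bars are all edges of $\mathcal P$ and, for each block, added edges on the vertices of the block and possibly further new vertices, such that these edges together with the boundary polygon of the block form an isostatic framework. An *equilibrium load* of a framework assigns to each joint a $2$-extensor through that joint, with total sum $0$; the *load of the bar* $ij$ is $p_i\vee p_j$ at $i$, $p_j\vee p_i$ at $j$ and $0$ elsewhere. A framework is *independent* if its bar loads are linearly independent (the only self-stress is $0$), *statically rigid* if every equilibrium load is a combination of bar loads, and *(geometrically) isostatic* if it is both. **Panel structure.** $G^M(\mathcal P,p)$ has as rigid bodies the faces of $\mathcal P$ that are not holes. An infinitesimal motion assigns a screw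 $S^F\in\mathbb R^6$ to each body $F$ so that, across every edge $ij$ between two bodies $F,F'$, $S^F-S^{F'}=\omega\,(p_i\vee p_j)$ for some $\omega\in\mathbb R$ (hinge), and, together with it, a velocity to each vertex so that all bodies at a vertex give that vertex its velocity and the velocities of the ends of every edge are those of a rigid motion of that edge (the structure stays joined at its vertices, also where several holes meet). It is *first-order rigid* if every such motion is induced by one screw $T$ for the whole structure. **Statement.** For every such $\mathcal P$ and $p$, and every choice of isostatic block frameworks for $\mathcal P$ and for $\overline{\mathcal P}$: 1. $G_S(\mathcal P,p)$ is isostatic if and only if $G_S(\overline{\mathcal P},p)$ is isostatic. 2. If $G_S(\overline{\mathcal P},p)$ is independent, then $G^M(\mathcal P,p)$ is first-order rigid. 3. If $G^M(\mathcal P,p)$ is first-order rigid, then $G_S(\overline{\mathcal P},p)$ is independent. If moreover at most one hole of $\mathcal P$ meets each vertex, then 2 and 3 also hold with $G^M(\mathcal P,p)$ taken as the bare body and hinge structure: the motions are the assignments of screws to the bodies that satisfy the hinge conditions alone, and rigidity means that all screws are equal. -/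

import Mathlib

/-- The six Pluecker coordinates `(d₁₄, d₂₄, d₃₄, d₂₃, d₃₁, d₁₂)` of the exterior product `a ∨ b` of
two points of projective 3-space that are given by homogeneous coordinates. -/
def join (a b : Fin 4 → ℝ) : Fin 6 → ℝ :=
  ![a 0 * b 3 - a 3 * b 0, a 1 * b 3 - a 3 * b 1, a 2 * b 3 - a 3 * b 2,
    a 1 * b 2 - a 2 * b 1, a 2 * b 0 - a 0 * b 2, a 0 * b 1 - a 1 * b 0]

/-- `L` is a 2-extensor through the point `a`. These are the forces that act at `a`, and they are
also the screws whose motion has velocity zero at `a` (the rotations about the lines through `a`). -/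
def Through (a : Fin 4 → ℝ) (L : Fin 6 → ℝ) : Prop := ∃ f : Fin 4 → ℝ, L = join f a

/-- A bar and joint framework with joints `J` and bars `B` in projective 3-space; the joints are
placed by homogeneous coordinates. -/
structure Framework (J B : Type*) where
  /-- the two joints of a bar -/
  ends : B → Sym2 J
  /-- the positions of the joints -/
  pos : J → Fin 4 → ℝ

namespace Framework

open Classical in
/-- The load of the bar `{i, j}`: it is `pᵢ ∨ pⱼ` at `i`, `pⱼ ∨ pᵢ` at `j` and `0` elsewhere. -/
noncomputable def endsLoad {J : Type*} (p : J → Fin 4 → ℝ) : Sym2 J → J → Fin 6 → ℝ :=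
  Sym2.lift ⟨fun i j => Pi.single i (join (p i) (p j)) + Pi.single j (join (p j) (p i)),
    fun _ _ => add_comm _ _⟩

variable {J B : Type*} (X : Framework J B)

/-- The load of the bar `b`, as a function of the joints. -/
noncomputable def barLoad (b : B) : J → Fin 6 → ℝ := endsLoad X.pos (X.ends b)

/-- The scalars `lam` on the bars form a self-stress: at every joint they are in equilibrium. -/
def IsSelfStress [Fintype B] (lam : B → ℝ) : Prop :=
  ∀ i : J, ∑ b, lam b • X.barLoad b i = 0

/-- The only self-stress is the trivial one. -/
def Independent [Fintype B] : Prop := ∀ lam : B → ℝ, X.IsSelfStress lam → lam = 0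

/-- An external load in equilibrium: a load through each joint, with sum zero. -/
def IsEquilibriumLoad [Fintype J] (L : J → Fin 6 → ℝ) : Prop :=
  (∀ i, Through (X.pos i) (L i)) ∧ ∑ i, L i = 0

/-- The scalars `lam` on the bars resolve the load `L`. -/
def Resolves [Fintype B] (lam : B → ℝ) (L : J → Fin 6 → ℝ) : Prop :=
  ∀ i : J, L i + ∑ b, lam b • X.barLoad b i = 0

/-- Every equilibrium load has a resolution by the bars. -/
def StaticallyRigid [Fintype J] [Fintype B] : Prop :=
  ∀ L : J → Fin 6 → ℝ, X.IsEquilibriumLoad L → ∃ lam : B → ℝ, X.Resolves lam L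

/-- The bar loads form a basis of the space of equilibrium loads. -/
def Isostatic [Fintype J] [Fintype B] : Prop := X.Independent ∧ X.StaticallyRigid

/-- The framework of a graph. -/
def ofGraph {J : Type*} (G : SimpleGraph J) (p : J → Fin 4 → ℝ) : Framework J G.edgeSet where
  ends e := e.1
  pos := p

end Framework

noncomputable instance edgeSetFintype {J : Type*} [Finite J] (G : SimpleGraph J) :
    Fintype G.edgeSet := Fintype.ofFinite _

/-- For a rotation system (a permutation `rot` of the darts, whose cycles list the darts that leave
a vertex in their counterclockwise order), the permutation that sends a dart to the next dart along
the boundary of the face on its left. -/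
def facePermOf {V : Type*} {G : SimpleGraph V} (rot : Equiv.Perm G.Dart) : Equiv.Perm G.Dart :=
  (Function.Involutive.toPerm SimpleGraph.Dart.symm SimpleGraph.Dart.symm_involutive).trans rot.symm

/-- An abstract spherical polyhedron: a finite 3-connected graph with an embedding in the sphere,
given by its rotation system. The faces are the cycles of `facePermOf rot`, and the surface that
carries the embedding is a sphere by Euler's formula. -/
structure SphericalPolyhedron (V : Type*) [Fintype V] where
  /-- the vertices and edges -/
  graph : SimpleGraph V
  /-- there are more than three vertices -/
  four_le : 4 ≤ Fintype.card V
  /-- deleting at most two vertices leaves a connected graph -/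
  connected : ∀ s : Finset V, s.card ≤ 2 → (graph.induce {v | v ∉ s}).Connected
  /-- the counterclockwise rotation of the darts about their initial vertices -/
  rot : Equiv.Perm graph.Dart
  /-- the cycles of the rotation are the sets of darts with a common initial vertex -/
  rot_cycle : ∀ d d' : graph.Dart, rot.SameCycle d d' ↔ d.fst = d'.fst
  /-- Euler's formula `|V| - |E| + |F| = 2` -/
  euler : Nat.card V + Nat.card (Quotient (Equiv.Perm.SameCycle.setoid (facePermOf rot))) =
    Nat.card graph.edgeSet + 2

namespace SphericalPolyhedron

variable {V : Type*} [Fintype V] (P : SphericalPolyhedron V)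

/-- The faces. -/
def Face : Type _ := Quotient (Equiv.Perm.SameCycle.setoid (facePermOf P.rot))

/-- The face on the left of a dart. The face on its right is `P.face d.symm`. -/
def face (d : P.graph.Dart) : P.Face := Quotient.mk _ d

instance : Finite P.graph.Dart :=
  Finite.of_injective SimpleGraph.Dart.toProd SimpleGraph.Dart.toProd_injective

instance : Finite P.Face := inferInstanceAs (Finite (Quotient _))

noncomputable instance : Fintype P.Face := Fintype.ofFinite _

/-- `v` is a vertex of the face `F`. -/
def OnFace (F : P.Face) (v : V) : Prop := ∃ d : P.graph.Dart, P.face d = F ∧ d.fst = v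

/-- The boundary polygon of a face `F`, as a graph on the vertices of `F` and `n` further vertices. -/
def polygon (F : P.Face) (n : ℕ) : SimpleGraph ({v : V // P.OnFace F v} ⊕ Fin n) where
  Adj x y := ∃ u v, x = Sum.inl u ∧ y = Sum.inl v ∧
    ∃ d : P.graph.Dart, P.face d = F ∧ d.edge = s(u.1, v.1)
  symm := ⟨by
    rintro x y ⟨u, v, hx, hy, d, hd, he⟩
    exact ⟨v, u, hy, hx, d, hd, he.trans Sym2.eq_swap⟩⟩
  loopless := ⟨by
    rintro x ⟨u, v, hx, hy, d, -, he⟩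
    obtain rfl : u = v := Sum.inl_injective (hx.symm.trans hy)
    have h := d.edge_mem
    rw [he] at h
    exact P.graph.loopless.irrefl _ h⟩

/-- A configuration of the polyhedron, in homogeneous coordinates: adjacent vertices are placed at
distinct points of projective space. (Every vertex has a neighbour, so no `p v` is zero.) -/
def IsConfiguration (p : V → Fin 4 → ℝ) : Prop :=
  ∀ u v, P.graph.Adj u v → LinearIndependent ℝ ![p u, p v]

/-- The vertices of the face `F` are placed on a line (or at a point). -/
def CollinearFace (p : V → Fin 4 → ℝ) (F : P.Face) : Prop :=
  Module.finrank ℝ (Submodule.span ℝ (p '' {v | P.OnFace F v})) ≤ 2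

/-- An isostatic subframework for the face `F`: new vertices `Fin n` and new edges on these and the
vertices of `F`, which together with the boundary polygon of `F` form an isostatic framework. -/
structure BlockFrame (p : V → Fin 4 → ℝ) (F : P.Face) where
  /-- the number of added vertices -/
  n : ℕ
  /-- the positions of the added vertices -/
  pos : Fin n → Fin 4 → ℝ
  pos_ne_zero : ∀ i, pos i ≠ 0
  /-- the added edges -/
  added : SimpleGraph ({v : V // P.OnFace F v} ⊕ Fin n)
  added_disjoint : Disjoint (P.polygon F n) added
  isostatic :
    letI : Fintype {v : V // P.OnFace F v} := Fintype.ofFinite _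
    (Framework.ofGraph (P.polygon F n ⊔ added) (Sum.elim (fun v => p v.1) pos)).Isostatic

end SphericalPolyhedron

/-- The three kinds of faces. -/
inductive FaceKind where
  | block
  | hole
  | surface
  deriving DecidableEq

/-- The exchange of blocks and holes. -/
def FaceKind.swap : FaceKind → FaceKind
  | block => hole
  | hole => block
  | surface => surface

/-- A block and hole polyhedron: a spherical polyhedron whose faces are partitioned into blocks,
holes and triangular surface faces. (The edges that triangulate the remaining faces of the original
spherical polyhedron belong to the graph; adding them keeps it planar, simple and 3-connected.) -/
structure BlockHolePolyhedron (V : Type*) [Fintype V] extends SphericalPolyhedron V where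
  /-- the partition of the faces -/
  kind : toSphericalPolyhedron.Face → FaceKind
  surface_triangle : ∀ F, kind F = FaceKind.surface →
    Nat.card {d : graph.Dart // toSphericalPolyhedron.face d = F} = 3

namespace BlockHolePolyhedron

variable {V : Type*} [Fintype V] (P : BlockHolePolyhedron V)

/-- The swapped polyhedron: blocks and holes are interchanged. -/
def swap : BlockHolePolyhedron V where
  toSphericalPolyhedron := P.toSphericalPolyhedron
  kind F := (P.kind F).swap
  surface_triangle F hF := P.surface_triangle F (by
    revert hF
    cases P.kind F <;> simp [FaceKind.swap])

/-- The blocks. -/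
abbrev Block : Type _ := {F : P.Face // P.kind F = FaceKind.block}

/-- The faces that are rigid bodies: the blocks and the surface triangles, but not the holes. -/
abbrev Body : Type _ := {F : P.Face // P.kind F ≠ FaceKind.hole}

/-- Block and hole general position: no block and no hole has all its vertices on one line. -/
def GeneralPosition (p : V → Fin 4 → ℝ) : Prop :=
  ∀ F, P.kind F ≠ FaceKind.surface → ¬ P.CollinearFace p F

/-- A choice of an isostatic subframework for every block. -/
abbrev BlockFilling (p : V → Fin 4 → ℝ) : Type _ := ∀ F : P.Block, P.BlockFrame p F.1

/-- The static framework `G_S(P, p)`: the bars are the edges of the polyhedron and the edges added in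
the blocks; the joints are the vertices of the polyhedron and the vertices added in the blocks. -/
def staticFramework (p : V → Fin 4 → ℝ) (I : P.BlockFilling p) :
    Framework (V ⊕ (Σ F : P.Block, Fin (I F).n))
      (P.graph.edgeSet ⊕ (Σ F : P.Block, (I F).added.edgeSet)) where
  ends := Sum.elim (fun e => e.1.map Sum.inl)
    (fun x => x.2.1.map (Sum.map Subtype.val (fun j => ⟨x.1, j⟩)))
  pos := Sum.elim p (fun x => (I x.1).pos x.2)

/-- At most one hole meets each vertex. -/
def Separated : Prop :=
  ∀ (v : V) (F F' : P.Face), P.OnFace F v → P.OnFace F' v →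
    P.kind F = FaceKind.hole → P.kind F' = FaceKind.hole → F = F'

/-- An infinitesimal motion of the body and hinge structure whose bodies are the rigid faces and
whose hinges are the edges between two rigid faces: a screw for each body such that, across each
hinge, the screws differ by a multiple of the 2-extensor of the hinge. -/
def IsHingeMotion (p : V → Fin 4 → ℝ) (S : P.Body → Fin 6 → ℝ) : Prop :=
  ∀ (d : P.graph.Dart) (k m : P.Body), P.face d.symm = k.1 → P.face d = m.1 →
    ∃ ω : ℝ, S k - S m = ω • join (p d.fst) (p d.snd)

/-- The body and hinge structure on the rigid faces is infinitesimally rigid. -/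
def HingeRigid (p : V → Fin 4 → ℝ) : Prop :=
  ∀ S : P.Body → Fin 6 → ℝ, P.IsHingeMotion p S → ∃ T, ∀ F, S F = T

/-- An infinitesimal motion of the hinged panel structure `G^M(P, p)` in which the panels and the
edges remain attached to each other at their vertices, also at a vertex where several holes meet.
Each rigid face `F` moves with a screw `S F`, as a body and hinge structure. Each vertex `v` has a
velocity, given as that of a screw `m v` at `p v`, so that `m v` matters only up to a screw that
fixes `p v`. The rigid faces at `v` induce that velocity, and each edge moves as a rigid bar. -/
structure IsPanelMotion (p : V → Fin 4 → ℝ) (S : P.Body → Fin 6 → ℝ) (m : V → Fin 6 → ℝ) :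
    Prop where
  hinge : P.IsHingeMotion p S
  face_vertex : ∀ (F : P.Body) (v : V), P.OnFace F.1 v → Through (p v) (S F - m v)
  bar : ∀ u v, P.graph.Adj u v → ∃ R : Fin 6 → ℝ, Through (p u) (R - m u) ∧ Through (p v) (R - m v)

/-- The hinged panel structure `G^M(P, p)` is first-order rigid: every infinitesimal motion is a rigid
motion of the whole structure. If `P` is separated, the joints at the vertices are a consequence of
the hinges, and this is the rigidity of the body and hinge structure. -/
def FirstOrderRigid (p : V → Fin 4 → ℝ) : Prop :=
  ∀ (S : P.Body → Fin 6 → ℝ) (m : V → Fin 6 → ℝ), P.IsPanelMotion p S m →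
    ∃ T : Fin 6 → ℝ, (∀ F, S F = T) ∧ ∀ v, Through (p v) (m v - T)

end BlockHolePolyhedron

/-! Self-stresses of the swapped framework, in which the holes carry frames, and motions of the
panel structure are two readings of one object: a screw `Q d` for each dart, that is, for each side
of a face. Across an edge `Q` changes by a multiple of the extensor of the edge; along a body it is
constant; at a corner of a hole at `v` it changes by a 2-extensor through `p v`.

Given a self-stress, the edge scalars prescribe the changes across edges, and the loads of the added
bars prescribe the changes at the corners of holes. Equilibrium at the vertices is the compatibility
condition, and since the first cohomology of the sphere vanishes (`exists_face_potential`), `Q`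
exists. On the bodies it is a panel motion. If that motion is a single screw `T`, then `Q d - T`
fixes both ends of `d`, so it is a multiple of the extensor of `d`; around a hole these multiples
belong to a self-stress of its frame, which is zero by independence (`PanelRigid.stressFree`).

Conversely, a motion defines `Q`, and its corner changes in a hole form an equilibrium load, which
the frame of the hole resolves by its static rigidity. The resolutions and the hinge coefficients
combine to a self-stress. If that vanishes, `Q`, corrected by the boundary part of the resolutions,
is one screw on the whole sphere (`StressFree.panelRigid`).

For the isostatic statement, virtual work turns static rigidity of the original framework into
first-order rigidity of the panels (`firstOrderRigid_of_staticallyRigid`), so the swapped framework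
is independent. The count of bars required for isostaticity is symmetric in blocks and holes
(`count_iff`), so the swapped framework is also statically rigid. For separated holes, walking
around a vertex from its only hole shows that the hinges alone keep the vertex joined. -/

/-! ### Plücker coordinates and incidence of points with 2-extensors. -/

theorem join_swap (a b : Fin 4 → ℝ) : join b a = -join a b := by
  ext i; fin_cases i <;> simp [join] <;> ring

theorem join_self (a : Fin 4 → ℝ) : join a a = 0 := by
  ext i; fin_cases i <;> simp [join] <;> ring

/-- The linear map `f ↦ f ∨ a`. -/
def joinRight (a : Fin 4 → ℝ) : (Fin 4 → ℝ) →ₗ[ℝ] (Fin 6 → ℝ) where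
  toFun f := join f a
  map_add' f g := by ext i; fin_cases i <;> simp [join] <;> ring
  map_smul' c f := by ext i; fin_cases i <;> simp [join] <;> ring

/-- The 2-extensors through a point. -/
def throughSubmodule (a : Fin 4 → ℝ) : Submodule ℝ (Fin 6 → ℝ) := LinearMap.range (joinRight a)

theorem mem_throughSubmodule {a : Fin 4 → ℝ} {L : Fin 6 → ℝ} :
    L ∈ throughSubmodule a ↔ Through a L :=
  ⟨fun ⟨f, hf⟩ => ⟨f, hf.symm⟩, fun ⟨f, hf⟩ => ⟨f, hf.symm⟩⟩

namespace Through

variable {a : Fin 4 → ℝ} {L K : Fin 6 → ℝ}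

theorem zero (a : Fin 4 → ℝ) : Through a 0 := mem_throughSubmodule.1 (Submodule.zero_mem _)

theorem add (hL : Through a L) (hK : Through a K) : Through a (L + K) :=
  mem_throughSubmodule.1 (Submodule.add_mem _ (mem_throughSubmodule.2 hL) (mem_throughSubmodule.2 hK))

theorem sub (hL : Through a L) (hK : Through a K) : Through a (L - K) :=
  mem_throughSubmodule.1 (Submodule.sub_mem _ (mem_throughSubmodule.2 hL) (mem_throughSubmodule.2 hK))

theorem neg (hL : Through a L) : Through a (-L) :=
  mem_throughSubmodule.1 (Submodule.neg_mem _ (mem_throughSubmodule.2 hL))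

theorem smul (c : ℝ) (hL : Through a L) : Through a (c • L) :=
  mem_throughSubmodule.1 (Submodule.smul_mem _ c (mem_throughSubmodule.2 hL))

theorem sum {ι : Type*} {s : Finset ι} {f : ι → Fin 6 → ℝ} (h : ∀ i ∈ s, Through a (f i)) :
    Through a (∑ i ∈ s, f i) :=
  mem_throughSubmodule.1 (Submodule.sum_mem _ fun i hi => mem_throughSubmodule.2 (h i hi))

theorem sub_comm (h : Through a (L - K)) : Through a (K - L) := by
  simpa using h.neg

theorem sub_trans {M : Fin 6 → ℝ} (h : Through a (L - K)) (h' : Through a (K - M)) :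
    Through a (L - M) := by
  simpa using h.add h'

theorem join_right (f a : Fin 4 → ℝ) : Through a (join f a) := ⟨f, rfl⟩

theorem join_left (a b : Fin 4 → ℝ) : Through a (join a b) := by
  rw [join_swap b a]; exact (join_right b a).neg

end Through

/-- The wedge product of a 2-extensor with a point, as a plane. -/
def wedge (L : Fin 6 → ℝ) : (Fin 4 → ℝ) →ₗ[ℝ] (Fin 4 → ℝ) where
  toFun a := ![L 5 * a 2 + L 3 * a 0 + L 4 * a 1, L 5 * a 3 + L 1 * a 0 - L 0 * a 1,
    L 2 * a 0 - L 4 * a 3 - L 0 * a 2, L 3 * a 3 + L 2 * a 1 - L 1 * a 2]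
  map_add' f g := by ext i; fin_cases i <;> simp <;> ring
  map_smul' c f := by ext i; fin_cases i <;> simp <;> ring

theorem wedge_eq_zero_iff {L : Fin 6 → ℝ} {a : Fin 4 → ℝ} : wedge L a = 0 ↔
    L 5 * a 2 + L 3 * a 0 + L 4 * a 1 = 0 ∧ L 5 * a 3 + L 1 * a 0 - L 0 * a 1 = 0 ∧
    L 2 * a 0 - L 4 * a 3 - L 0 * a 2 = 0 ∧ L 3 * a 3 + L 2 * a 1 - L 1 * a 2 = 0 := by
  simp [wedge, funext_iff, Fin.forall_fin_succ]

theorem Through.wedge_eq_zero {L : Fin 6 → ℝ} {a : Fin 4 → ℝ} (h : Through a L) :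
    wedge L a = 0 := by
  obtain ⟨f, rfl⟩ := h
  rw [wedge_eq_zero_iff]
  simp only [join, Matrix.cons_val]
  refine ⟨?_, ?_, ?_, ?_⟩ <;> ring

theorem through_of_wedge_eq_zero {L : Fin 6 → ℝ} {a : Fin 4 → ℝ} (ha : a ≠ 0)
    (h : wedge L a = 0) : Through a L := by
  rw [wedge_eq_zero_iff] at h
  obtain ⟨h0, h1, h2, h3⟩ := h
  obtain ⟨k, hk⟩ := Function.ne_iff.1 ha
  -- The other point matters only up to multiples of `a`, so its `k`-th coordinate can be made zero;
  -- the remaining ones are then read off from `L`.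
  fin_cases k <;> simp at hk
  · refine ⟨![0, -L 5 / a 0, L 4 / a 0, -L 0 / a 0], ?_⟩
    ext i; fin_cases i <;> simp [join] <;> field_simp <;> linarith
  · refine ⟨![L 5 / a 1, 0, -L 3 / a 1, -L 1 / a 1], ?_⟩
    ext i; fin_cases i <;> simp [join] <;> field_simp <;> linarith
  · refine ⟨![-L 4 / a 2, L 3 / a 2, 0, -L 2 / a 2], ?_⟩
    ext i; fin_cases i <;> simp [join] <;> field_simp <;> linarith
  · refine ⟨![L 0 / a 3, L 1 / a 3, L 2 / a 3, 0], ?_⟩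
    ext i; fin_cases i <;> simp [join] <;> field_simp <;> linarith

theorem not_linearIndependent_of_join_eq_zero {a b : Fin 4 → ℝ} (h : join a b = 0) :
    ¬ LinearIndependent ℝ ![a, b] := by
  intro hab
  rw [LinearIndependent.pair_iff] at hab
  have e : ∀ i : Fin 6, join a b i = 0 := fun i => by rw [h]; rfl
  have e0 := e 0
  have e1 := e 1
  have e2 := e 2
  have e3 := e 3
  have e4 := e 4
  have e5 := e 5
  simp only [join, Matrix.cons_val] at e0 e1 e2 e3 e4 e5
  have key : ∀ k, b k = 0 := by
    intro k
    have h1 : b k • a + (-a k) • b = 0 := by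
      ext i
      simp only [Pi.add_apply, Pi.smul_apply, smul_eq_mul, Pi.zero_apply]
      fin_cases k <;> fin_cases i <;> simp only [Fin.zero_eta, Fin.mk_one, Fin.reduceFinMk] <;>
        linarith
    exact (hab _ _ h1).1
  have : (0 : ℝ) • a + (1 : ℝ) • b = 0 := by
    ext i; simp [key i]
  exact one_ne_zero (hab _ _ this).2

theorem exists_eq_smul_join {a b : Fin 4 → ℝ} {L : Fin 6 → ℝ} (hab : LinearIndependent ℝ ![a, b])
    (ha : Through a L) (hb : Through b L) : ∃ c : ℝ, L = c • join a b := by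
  obtain ⟨a0, a1, a2, a3⟩ := wedge_eq_zero_iff.1 ha.wedge_eq_zero
  obtain ⟨b0, b1, b2, b3⟩ := wedge_eq_zero_iff.1 hb.wedge_eq_zero
  have hne : join a b ≠ 0 := fun h => not_linearIndependent_of_join_eq_zero h hab
  -- Proportionality in the form of vanishing 2×2 minors; each follows from the linear incidence
  -- equations of `L` with `a` and with `b`.
  have key : ∀ i j, L i * join a b j = L j * join a b i := by
    clear hne ha hb hab
    intro i j
    fin_cases i <;> fin_cases j <;>
      simp only [join, Fin.zero_eta, Fin.mk_one, Fin.reduceFinMk, Matrix.cons_val] <;> grind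
  obtain ⟨k, hk⟩ := Function.ne_iff.1 hne
  refine ⟨L k / join a b k, ?_⟩
  ext i
  have := key i k
  simp only [Pi.zero_apply] at hk
  simp only [Pi.smul_apply, smul_eq_mul]
  field_simp
  linarith

theorem join_smul_add_smul (a b c : Fin 4 → ℝ) (s t : ℝ) :
    join a (s • b + t • c) = s • join a b + t • join a c := by
  ext i; fin_cases i <;> simp [join] <;> ring

/-- `L` is a multiple of both `a ∨ b` and `a ∨ c`. If it were nonzero, `a` would be dependent on a
nontrivial combination of `b` and `c`. -/
theorem eq_zero_of_through_of_linearIndependent {a b c : Fin 4 → ℝ} {L : Fin 6 → ℝ}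
    (h : LinearIndependent ℝ ![a, b, c]) (ha : Through a L) (hb : Through b L)
    (hc : Through c L) : L = 0 := by
  have hab : LinearIndependent ℝ ![a, b] := by
    have := h.comp ![0, 1] (by decide)
    convert this using 1
    ext i; fin_cases i <;> rfl
  have hac : LinearIndependent ℝ ![a, c] := by
    have := h.comp ![0, 2] (by decide)
    convert this using 1
    ext i; fin_cases i <;> rfl
  obtain ⟨s, hs⟩ := exists_eq_smul_join hab ha hb
  obtain ⟨t, ht⟩ := exists_eq_smul_join hac ha hc
  by_cases h0 : s = 0
  · rw [hs, h0, zero_smul]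
  exfalso
  have hj : join a (s • b + (-t) • c) = 0 := by
    rw [join_smul_add_smul, ← hs, neg_smul, ← ht, add_neg_cancel]
  apply not_linearIndependent_of_join_eq_zero hj
  rw [LinearIndependent.pair_iff]
  intro x y hxy
  have := (Fintype.linearIndependent_iff.1 h) ![x, y * s, y * -t] (by
    simp only [Fin.sum_univ_three, Matrix.cons_val]
    rw [← hxy, smul_add, smul_smul, smul_smul, add_assoc])
  have h1 := this 0
  have h2 := this 1
  simp only [Matrix.cons_val, mul_eq_zero] at h1 h2
  exact ⟨h1, h2.resolve_right h0⟩

/-- A screw that fixes points which do not lie on a line is zero. -/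
theorem eq_zero_of_forall_through {ι : Type*} {p : ι → Fin 4 → ℝ} {s : Set ι} {L : Fin 6 → ℝ}
    (hs : ¬ Module.finrank ℝ (Submodule.span ℝ (p '' s)) ≤ 2) (h : ∀ i ∈ s, Through (p i) L) :
    L = 0 := by
  by_contra hL
  apply hs
  -- The vectors annihilated by `wedge L` form a subspace. If its dimension were at least three,
  -- three independent members would force `L = 0`.
  have hle : Submodule.span ℝ (p '' s) ≤ LinearMap.ker (wedge L) := by
    rw [Submodule.span_le]
    rintro _ ⟨i, hi, rfl⟩
    exact (h i hi).wedge_eq_zero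
  refine (Submodule.finrank_mono hle).trans ?_
  by_contra h3
  push Not at h3
  let v := Module.finBasis ℝ (LinearMap.ker (wedge L))
  have hv := v.linearIndependent.map' (LinearMap.ker (wedge L)).subtype (Submodule.ker_subtype _)
  have hv3 := hv.comp (Fin.castLE h3) (Fin.castLE_injective _)
  have hth : ∀ i : Fin 3, Through ((v (Fin.castLE h3 i)).1) L := fun i =>
    through_of_wedge_eq_zero (hv3.ne_zero i) (v (Fin.castLE h3 i)).2
  have e : (((LinearMap.ker (wedge L)).subtype ∘ v) ∘ Fin.castLE h3) =
      ![(v (Fin.castLE h3 0)).1, (v (Fin.castLE h3 1)).1, (v (Fin.castLE h3 2)).1] := by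
    ext i; fin_cases i <;> rfl
  rw [e] at hv3
  exact hL (eq_zero_of_through_of_linearIndependent hv3 (hth 0) (hth 1) (hth 2))

/-- The join of two points on a line is a multiple of the join of two different points of it. -/
theorem exists_join_eq_smul_join {W : Submodule ℝ (Fin 4 → ℝ)} (hW : Module.finrank ℝ W ≤ 2)
    {a b c d : Fin 4 → ℝ} (ha : a ∈ W) (hb : b ∈ W) (hc : c ∈ W) (hd : d ∈ W)
    (hcd : LinearIndependent ℝ ![c, d]) : ∃ t : ℝ, join a b = t • join c d := by
  have hspan : Submodule.span ℝ (Set.range ![c, d]) = W := by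
    apply Submodule.eq_of_le_of_finrank_le
    · rw [Submodule.span_le]
      rintro _ ⟨i, rfl⟩
      fin_cases i
      exacts [hc, hd]
    · rw [finrank_span_eq_card hcd]; simpa using hW
  rw [← hspan, Matrix.range_cons_cons_empty, Submodule.mem_span_pair] at ha hb
  obtain ⟨x, y, rfl⟩ := ha
  obtain ⟨z, w, rfl⟩ := hb
  refine ⟨x * w - y * z, ?_⟩
  ext i; fin_cases i <;> simp [join] <;> ring

theorem finrank_throughSubmodule {a : Fin 4 → ℝ} (ha : a ≠ 0) :
    Module.finrank ℝ (throughSubmodule a) = 3 := by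
  have hker : LinearMap.ker (joinRight a) = Submodule.span ℝ {a} := by
    ext f
    rw [LinearMap.mem_ker, Submodule.mem_span_singleton]
    constructor
    · intro h
      have := not_linearIndependent_of_join_eq_zero (a := a) (b := f)
        (by rw [join_swap f a]; exact neg_eq_zero.2 h)
      rw [LinearIndependent.pair_iff' ha] at this
      push Not at this
      exact this
    · rintro ⟨c, rfl⟩
      rw [map_smul]
      simp [joinRight, join_self]
  have h := LinearMap.finrank_range_add_finrank_ker (joinRight a)
  rw [hker, finrank_span_singleton ha] at h
  simp at h
  exact h

/-! ### The duality of screws and forces. -/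

/-- The pairing of screws with 2-extensors. -/
def screwPairing : (Fin 6 → ℝ) →ₗ[ℝ] (Fin 6 → ℝ) →ₗ[ℝ] ℝ :=
  LinearMap.mk₂ ℝ (fun S L => S 0 * L 3 + S 1 * L 4 + S 2 * L 5 + S 3 * L 0 + S 4 * L 1 + S 5 * L 2)
    (fun _ _ _ => by simp only [Pi.add_apply]; ring)
    (fun _ _ _ => by simp only [Pi.smul_apply, smul_eq_mul]; ring)
    (fun _ _ _ => by simp only [Pi.add_apply]; ring)
    (fun _ _ _ => by simp only [Pi.smul_apply, smul_eq_mul]; ring)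

theorem screwPairing_apply (S L : Fin 6 → ℝ) : screwPairing S L =
    S 0 * L 3 + S 1 * L 4 + S 2 * L 5 + S 3 * L 0 + S 4 * L 1 + S 5 * L 2 := rfl

theorem Through.screwPairing_eq_zero {a : Fin 4 → ℝ} {S L : Fin 6 → ℝ} (hS : Through a S)
    (hL : Through a L) : screwPairing S L = 0 := by
  obtain ⟨f, rfl⟩ := hS
  obtain ⟨g, rfl⟩ := hL
  simp only [screwPairing_apply, join, Matrix.cons_val]
  ring

/-- The extensors through `a` are their own orthogonal space: pairing with the joins of `a` and the
four basis vectors gives, up to sign, the coordinates of `wedge S a`. -/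
theorem through_of_screwPairing_eq_zero {a : Fin 4 → ℝ} (ha : a ≠ 0) {S : Fin 6 → ℝ}
    (h : ∀ L, Through a L → screwPairing S L = 0) : Through a S := by
  apply through_of_wedge_eq_zero ha
  rw [wedge_eq_zero_iff]
  have h0 := h _ (.join_right ![1, 0, 0, 0] a)
  have h1 := h _ (.join_right ![0, 1, 0, 0] a)
  have h2 := h _ (.join_right ![0, 0, 1, 0] a)
  have h3 := h _ (.join_right ![0, 0, 0, 1] a)
  simp only [screwPairing_apply, join, Matrix.cons_val] at h0 h1 h2 h3
  refine ⟨?_, ?_, ?_, ?_⟩ <;> linarith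

theorem exists_screwPairing_eq (φ : (Fin 6 → ℝ) →ₗ[ℝ] ℝ) : ∃ T, ∀ L, φ L = screwPairing T L := by
  -- The pairing matches coordinate `i` with coordinate `i + 3` modulo 6.
  refine ⟨![φ (Pi.single 3 1), φ (Pi.single 4 1), φ (Pi.single 5 1), φ (Pi.single 0 1),
    φ (Pi.single 1 1), φ (Pi.single 2 1)], fun L => ?_⟩
  rw [LinearMap.pi_apply_eq_sum_univ φ L]
  simp only [screwPairing_apply, Matrix.cons_val, Fin.sum_univ_six, smul_eq_mul]
  have : ∀ i : Fin 6, (fun j => if i = j then (1 : ℝ) else 0) = Pi.single i 1 := by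
    intro i; ext j; simp [Pi.single_apply, eq_comm]
  simp only [this]
  ring

/-! ### Primitives along the cycles of a permutation. -/

/-- A function on the points of a permutation that has sum zero on each cycle is the difference of
a function along the permutation. The fibres of `r` are the cycles. -/
theorem exists_sub_eq_of_sum_cycle_eq_zero {X Y M : Type*} [Fintype X] [DecidableEq Y]
    [AddCommGroup M] [Module ℝ M] (σ : Equiv.Perm X) (r : X → Y)
    (hr : ∀ x y, σ.SameCycle x y ↔ r x = r y) (f : X → M)
    (hf : ∀ x, ∑ y with r y = r x, f y = 0) : ∃ q : X → M, ∀ x, q (σ x) - q x = f x := by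
  classical
  set N := orderOf σ with hN
  have hNpos : 0 < N := orderOf_pos σ
  have hrσ : ∀ (j : ℕ) x, r ((σ ^ j) x) = r x := fun j x =>
    ((hr _ _).1 (Equiv.Perm.SameCycle.refl σ x |>.pow_right)).symm
  have hinv : ∀ x, ∑ j ∈ Finset.range N, f ((σ ^ j) (σ x)) = ∑ j ∈ Finset.range N, f ((σ ^ j) x) := by
    intro x
    have h1 : ∀ j, f ((σ ^ j) (σ x)) = f ((σ ^ (j + 1)) x) := fun j => by
      rw [pow_succ, Equiv.Perm.mul_apply]
    simp only [h1]
    have h2 := Finset.sum_range_succ' (fun j => f ((σ ^ j) x)) N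
    rw [Finset.sum_range_succ, hN, pow_orderOf_eq_one, pow_zero] at h2
    exact (add_right_cancel h2).symm
  have hinv' : ∀ (n : ℕ) x, ∑ j ∈ Finset.range N, f ((σ ^ j) ((σ ^ n) x)) =
      ∑ j ∈ Finset.range N, f ((σ ^ j) x) := by
    intro n x
    induction n with
    | zero => simp
    | succ n ih => rw [pow_succ', Equiv.Perm.mul_apply, hinv, ih]
  -- The sum over `N` steps is constant on a cycle, and its total over the cycle is zero because
  -- each shift of `f` has total zero there.
  have hzero : ∀ x, ∑ j ∈ Finset.range N, f ((σ ^ j) x) = 0 := by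
    intro x
    have h1 : ∑ y with r y = r x, ∑ j ∈ Finset.range N, f ((σ ^ j) y) = 0 := by
      rw [Finset.sum_comm]
      refine Finset.sum_eq_zero fun j _ => ?_
      rw [← hf x]
      refine Finset.sum_equiv (σ ^ j) (fun y => ?_) (fun y _ => rfl)
      simp [hrσ]
    have h2 : ∀ y ∈ Finset.univ.filter (fun y => r y = r x),
        ∑ j ∈ Finset.range N, f ((σ ^ j) y) = ∑ j ∈ Finset.range N, f ((σ ^ j) x) := by
      intro y hy
      obtain ⟨n, -, -, rfl⟩ := ((hr x y).2 (Finset.mem_filter.1 hy).2.symm).exists_pow_eq''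
      exact hinv' n x
    rw [Finset.sum_congr rfl h2, Finset.sum_const] at h1
    have : (Finset.univ.filter (fun y => r y = r x)).card ≠ 0 :=
      Finset.card_ne_zero_of_mem (a := x) (by simp)
    rw [← Nat.cast_smul_eq_nsmul ℝ] at h1
    exact (smul_eq_zero.1 h1).resolve_left (by exact_mod_cast this)
  -- Averaging the partial sums of all lengths below `N` gives a primitive without the choice of a
  -- base point on each cycle.
  refine ⟨fun x => -((N : ℝ)⁻¹ • ∑ j ∈ Finset.range N, ∑ i ∈ Finset.range j, f ((σ ^ i) x)),
    fun x => ?_⟩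
  have h3 : ∀ j, ∑ i ∈ Finset.range j, f ((σ ^ i) (σ x)) =
      ∑ i ∈ Finset.range j, f ((σ ^ i) x) + (f ((σ ^ j) x) - f x) := by
    intro j
    have h1 : ∀ j, f ((σ ^ j) (σ x)) = f ((σ ^ (j + 1)) x) := fun j => by
      rw [pow_succ, Equiv.Perm.mul_apply]
    simp only [h1]
    have h2 := Finset.sum_range_succ' (fun j => f ((σ ^ j) x)) j
    rw [Finset.sum_range_succ, pow_zero] at h2
    rw [eq_sub_of_add_eq h2.symm]
    simp only [Equiv.Perm.one_apply]
    abel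
  have h4 : ∑ j ∈ Finset.range N, ∑ i ∈ Finset.range j, f ((σ ^ i) (σ x)) =
      ∑ j ∈ Finset.range N, ∑ i ∈ Finset.range j, f ((σ ^ i) x) - (N : ℝ) • f x := by
    simp only [h3, Finset.sum_add_distrib, Finset.sum_sub_distrib, hzero, Finset.sum_const,
      Finset.card_range, Nat.cast_smul_eq_nsmul]
    abel
  simp only [h4, smul_sub]
  rw [inv_smul_smul₀ (by exact_mod_cast hNpos.ne')]
  abel

/-! ### The sphere: Euler's formula as vanishing of cohomology, and consequences of 3-connectedness.
-/

namespace SphericalPolyhedron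

variable {V : Type*} [Fintype V] (P : SphericalPolyhedron V)

noncomputable instance : Fintype P.graph.Dart := Fintype.ofFinite _

/-- The next dart along the boundary of the face on the left. -/
abbrev next : Equiv.Perm P.graph.Dart := facePermOf P.rot

variable {P}

theorem next_apply (d : P.graph.Dart) : P.next d = P.rot.symm d.symm := rfl

theorem rot_next (d : P.graph.Dart) : P.rot (P.next d) = d.symm := by
  simp [next_apply]

theorem next_symm_rot (d : P.graph.Dart) : P.next (P.rot d).symm = d := by
  simp [next_apply]

theorem rot_fst (d : P.graph.Dart) : (P.rot d).fst = d.fst :=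
  ((P.rot_cycle d (P.rot d)).1 (Equiv.Perm.SameCycle.refl _ _ |>.apply_right)).symm

theorem next_fst (d : P.graph.Dart) : (P.next d).fst = d.snd := by
  rw [← rot_fst, rot_next]; rfl

theorem face_eq_iff {d e : P.graph.Dart} : P.face d = P.face e ↔ P.next.SameCycle d e :=
  Quotient.eq (r := Equiv.Perm.SameCycle.setoid (facePermOf P.rot))

theorem face_next (d : P.graph.Dart) : P.face (P.next d) = P.face d :=
  (face_eq_iff.2 (Equiv.Perm.SameCycle.refl _ _ |>.apply_right)).symm

theorem face_symm_rot (d : P.graph.Dart) : P.face (P.rot d).symm = P.face d := by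
  rw [← face_next, next_symm_rot]

theorem exists_face_eq (F : P.Face) : ∃ d, P.face d = F := Quotient.exists_rep F

/-- A function that is constant along the edges of the polyhedron without at most two vertices is
constant. -/
theorem eq_of_forall_adj {α : Type*} {s : Finset V} (hs : s.card ≤ 2) {x : V → α}
    (hx : ∀ u v, P.graph.Adj u v → u ∉ s → v ∉ s → x u = x v) {u v : V} (hu : u ∉ s)
    (hv : v ∉ s) : x u = x v := by
  obtain ⟨w⟩ := (P.connected s hs).preconnected ⟨u, hu⟩ ⟨v, hv⟩
  have key : ∀ {a b : {v | v ∉ s}}, (P.graph.induce {v | v ∉ s}).Walk a b → x a.1 = x b.1 := by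
    intro a b w
    induction w with
    | nil => rfl
    | @cons a c b h _ ih => exact (hx _ _ h a.2 c.2).trans ih
  exact key w

/-- Otherwise `v` would be isolated after deleting `s`, although at least one other vertex remains.
-/
theorem exists_adj_not_mem (v : V) {s : Finset V} (hs : s.card ≤ 2) (hv : v ∉ s) :
    ∃ w, P.graph.Adj v w ∧ w ∉ s := by
  classical
  by_contra! h
  have hcard : (insert v s).card < Fintype.card V :=
    (Finset.card_insert_le v s).trans_lt (by have := P.four_le; omega)
  obtain ⟨w, hw⟩ : ∃ w, w ∉ insert v s := by
    by_contra! hall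
    exact hcard.ne (by rw [Finset.eq_univ_of_forall hall, Finset.card_univ])
  rw [Finset.mem_insert, not_or] at hw
  have := P.eq_of_forall_adj hs (x := fun u => u = v) (fun a b hab ha hb => by
    refine propext ⟨?_, ?_⟩
    · rintro rfl; exact absurd (h _ hab) hb
    · rintro rfl; exact absurd (h _ hab.symm) ha) hw.2 hv
  simp [hw.1] at this

theorem exists_dart (v : V) : ∃ d : P.graph.Dart, d.fst = v := by
  obtain ⟨w, hw, -⟩ := P.exists_adj_not_mem v (s := ∅) (by simp) (by simp)
  exact ⟨⟨(v, w), hw⟩, rfl⟩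

/-- A fixed dart would be the only one at its vertex, but every vertex has a second neighbour. -/
theorem rot_ne_self (d : P.graph.Dart) : P.rot d ≠ d := by
  intro h
  obtain ⟨w, hw, hwd⟩ := P.exists_adj_not_mem d.fst (s := {d.snd}) (by simp)
    (by simp [d.fst_ne_snd])
  obtain ⟨n, -, -, hn⟩ := ((P.rot_cycle d ⟨(d.fst, w), hw⟩).2 rfl).exists_pow_eq''
  have : ∀ n : ℕ, (P.rot ^ n) d = d := fun n => by
    induction n with
    | zero => rfl
    | succ n ih => rw [pow_succ', Equiv.Perm.mul_apply, ih, h]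
  rw [this] at hn
  apply hwd
  rw [hn]
  simp

/-- The dual graph is connected: the rotation links the faces around a vertex, and the graph links
the vertices. -/
theorem eq_of_forall_face {α : Type*} {y : P.Face → α}
    (hy : ∀ d, y (P.face d) = y (P.face d.symm)) (F G : P.Face) : y F = y G := by
  obtain ⟨d, rfl⟩ := exists_face_eq F
  obtain ⟨e, rfl⟩ := exists_face_eq G
  have hrot : ∀ d, y (P.face (P.rot d)) = y (P.face d) := fun d => by
    rw [hy, face_symm_rot]
  have hsame : ∀ d e : P.graph.Dart, d.fst = e.fst → y (P.face d) = y (P.face e) := by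
    intro d e h
    obtain ⟨n, -, -, rfl⟩ := ((P.rot_cycle d e).2 h).exists_pow_eq''
    clear h
    induction n with
    | zero => rfl
    | succ n ih => rw [pow_succ', Equiv.Perm.mul_apply, hrot, ih]
  choose D hD using P.exists_dart
  have := P.eq_of_forall_adj (s := ∅) (by simp) (x := fun v => y (P.face (D v)))
    (fun u v huv _ _ => by
      rw [hsame (D u) ⟨(u, v), huv⟩ (hD u), hsame (D v) ⟨(v, u), huv.symm⟩ (hD v), hy]
      rfl) (u := d.fst) (v := e.fst) (by simp) (by simp)
  rw [hsame d (D d.fst) (hD _).symm, this, hsame _ e (hD _)]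

theorem card_dart : Fintype.card P.graph.Dart = 2 * Nat.card P.graph.edgeSet := by
  classical
  have h : Nat.card P.graph.edgeSet = P.graph.edgeFinset.card := by
    rw [Nat.card_coe_set_eq, Set.ncard_eq_toFinset_card', SimpleGraph.edgeFinset]
  rw [h]
  convert P.graph.dart_card_eq_twice_card_edges

theorem sum_symm {M : Type*} [AddCommMonoid M] (f : P.graph.Dart → M) :
    ∑ d : P.graph.Dart, f d.symm = ∑ d, f d :=
  Equiv.sum_comp (Function.Involutive.toPerm SimpleGraph.Dart.symm
    SimpleGraph.Dart.symm_involutive) f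

theorem sum_next {M : Type*} [AddCommMonoid M] (f : P.graph.Dart → M) :
    ∑ d, f (P.next d) = ∑ d, f d := Equiv.sum_comp P.next f

/-- Cuts and cycles are orthogonal. -/
theorem sum_coboundary_mul_coboundary (x : V → ℝ) (y : P.Face → ℝ) :
    ∑ d : P.graph.Dart, (x d.snd - x d.fst) * (y (P.face d) - y (P.face d.symm)) = 0 := by
  have h1 : ∑ d : P.graph.Dart, (x d.snd - x d.fst) * y (P.face d) = 0 := by
    simp only [sub_mul, Finset.sum_sub_distrib]
    rw [← P.sum_next (fun d => x d.fst * y (P.face d))]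
    simp [next_fst, face_next]
  have h2 := P.sum_symm (fun d => (x d.snd - x d.fst) * y (P.face d))
  rw [h1] at h2
  have h3 : ∀ d : P.graph.Dart, (x d.snd - x d.fst) * (y (P.face d) - y (P.face d.symm)) =
      (x d.snd - x d.fst) * y (P.face d) + (x d.symm.snd - x d.symm.fst) * y (P.face d.symm) := by
    intro d
    simp only [SimpleGraph.Dart.symm, Prod.fst_swap, Prod.snd_swap]
    ring
  simp only [h3, Finset.sum_add_distrib, h1, h2, add_zero]

/-- A dimension count. The symmetric functions, vertex potentials and face potentials have total
dimension `|E| + |V| + |F|`, which by Euler's formula is `2|E| + 2`; the only relations are the two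
constants, so the image has the full dimension `2|E|`. -/
theorem exists_decomposition (g : P.graph.Dart → ℝ) :
    ∃ (s : P.graph.edgeSet → ℝ) (x : V → ℝ) (y : P.Face → ℝ), ∀ d, g d =
      s ⟨d.edge, d.edge_mem⟩ + (x d.snd - x d.fst) + (y (P.face d) - y (P.face d.symm)) := by
  let Φ : ((P.graph.edgeSet → ℝ) × (V → ℝ) × (P.Face → ℝ)) →ₗ[ℝ] (P.graph.Dart → ℝ) :=
    { toFun := fun t d => t.1 ⟨d.edge, d.edge_mem⟩ + (t.2.1 d.snd - t.2.1 d.fst) +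
        (t.2.2 (P.face d) - t.2.2 (P.face d.symm))
      map_add' := fun a b => by ext d; simp only [Prod.fst_add, Prod.snd_add, Pi.add_apply]; ring
      map_smul' := fun c a => by
        ext d
        simp only [Prod.smul_fst, Prod.smul_snd, Pi.smul_apply, smul_eq_mul, RingHom.id_apply]
        ring }
  let Ψ : (ℝ × ℝ) →ₗ[ℝ] ((P.graph.edgeSet → ℝ) × (V → ℝ) × (P.Face → ℝ)) :=
    { toFun := fun c => (0, fun _ => c.1, fun _ => c.2)
      map_add' := fun a b => by ext <;> simp
      map_smul' := fun c a => by ext <;> simp }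
  have hker : LinearMap.ker Φ ≤ LinearMap.range Ψ := by
    rintro ⟨s, x, y⟩ h
    have h0 : ∀ d : P.graph.Dart, s ⟨d.edge, d.edge_mem⟩ + (x d.snd - x d.fst) +
      (y (P.face d) - y (P.face d.symm)) = 0 := fun d => congrFun (LinearMap.mem_ker.1 h) d
    have h1 : ∀ d : P.graph.Dart, s ⟨d.edge, d.edge_mem⟩ + (x d.fst - x d.snd) +
      (y (P.face d.symm) - y (P.face d)) = 0 := fun d => by
      have := h0 d.symm
      simp only [SimpleGraph.Dart.edge_symm, SimpleGraph.Dart.symm_symm] at this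
      exact this
    -- Reversing the dart keeps `s` and changes the sign of both coboundaries. What remains is a cut
    -- that is also a cycle, so it is orthogonal to itself.
    have hs : ∀ d : P.graph.Dart, s ⟨d.edge, d.edge_mem⟩ = 0 := fun d => by
      linarith [h0 d, h1 d]
    have hxy : ∀ d : P.graph.Dart, y (P.face d) - y (P.face d.symm) = -(x d.snd - x d.fst) :=
      fun d => by linarith [h0 d, hs d]
    have hsq : ∑ d : P.graph.Dart, (x d.snd - x d.fst) ^ 2 = 0 := by
      have := P.sum_coboundary_mul_coboundary x y
      simp only [hxy, mul_neg, Finset.sum_neg_distrib, neg_eq_zero, ← pow_two] at this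
      exact this
    rw [Finset.sum_eq_zero_iff_of_nonneg (fun _ _ => sq_nonneg _)] at hsq
    have hx : ∀ d : P.graph.Dart, x d.snd - x d.fst = 0 := fun d =>
      pow_eq_zero_iff two_ne_zero |>.1 (hsq d (Finset.mem_univ d))
    obtain ⟨v⟩ : Nonempty V := Fintype.card_pos_iff.1 (by have := P.four_le; omega)
    obtain ⟨d, -⟩ := P.exists_dart v
    refine ⟨(x v, y (P.face d)), ?_⟩
    refine Prod.ext ?_ (Prod.ext ?_ ?_)
    · funext ⟨e, he⟩
      induction e with
      | _ a b => exact (hs ⟨(a, b), he⟩).symm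
    · funext w
      exact P.eq_of_forall_adj (s := ∅) (by simp)
        (fun a b hab _ _ => (sub_eq_zero.1 (hx ⟨(a, b), hab⟩)).symm) (by simp) (by simp)
    · funext F
      exact P.eq_of_forall_face (y := y) (fun d => by linarith [hxy d, hx d]) _ _
  have hk2 : Module.finrank ℝ (LinearMap.ker Φ) ≤ 2 :=
    (Submodule.finrank_mono hker).trans ((LinearMap.finrank_range_le Ψ).trans (by simp))
  have hrn := LinearMap.finrank_range_add_finrank_ker Φ
  have hE := P.euler
  change Nat.card V + Nat.card P.Face = _ at hE
  have hsurj : LinearMap.range Φ = ⊤ := by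
    apply Submodule.eq_top_of_finrank_eq
    apply le_antisymm (Submodule.finrank_le _)
    simp only [Module.finrank_prod, Module.finrank_fintype_fun_eq_card] at hrn ⊢
    rw [card_dart]
    simp only [← Nat.card_eq_fintype_card] at hrn
    omega
  obtain ⟨⟨s, x, y⟩, h⟩ := LinearMap.range_eq_top.1 hsurj g
  exact ⟨s, x, y, fun d => (congrFun h d).symm⟩

-- Antisymmetry removes the symmetric part of the decomposition. The face coboundary that is left is
-- orthogonal to `g`, by the face sums, and to the vertex coboundary, hence to itself.
open Classical in
theorem exists_vertex_potential {g : P.graph.Dart → ℝ} (hg : ∀ d, g d.symm = -g d)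
    (hF : ∀ F, ∑ d with P.face d = F, g d = 0) : ∃ x : V → ℝ, ∀ d, g d = x d.snd - x d.fst := by
  obtain ⟨s, x, y, h⟩ := P.exists_decomposition g
  have hs : ∀ d : P.graph.Dart, s ⟨d.edge, d.edge_mem⟩ = 0 := fun d => by
    have h1 := h d
    have h2 := h d.symm
    rw [hg] at h2
    simp only [SimpleGraph.Dart.edge_symm, SimpleGraph.Dart.symm_symm] at h2
    simp only [SimpleGraph.Dart.symm, Prod.fst_swap, Prod.snd_swap] at h1 h2
    linarith
  have hy : ∀ d, g d - (x d.snd - x d.fst) = y (P.face d) - y (P.face d.symm) := fun d => by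
    rw [h d, hs d]; ring
  have h1 : ∑ d, g d * y (P.face d) = 0 := by
    rw [← Finset.sum_fiberwise (s := Finset.univ) (g := P.face)]
    refine Finset.sum_eq_zero fun F _ => ?_
    rw [Finset.sum_congr rfl (g := fun d => g d * y F)
      (fun d hd => by rw [(Finset.mem_filter.1 hd).2]), ← Finset.sum_mul, hF, zero_mul]
  have h2 := P.sum_symm (fun d => g d * y (P.face d))
  have h3 := P.sum_coboundary_mul_coboundary x y
  have h4 : ∑ d, (y (P.face d) - y (P.face d.symm)) ^ 2 = 0 := by
    calc ∑ d, (y (P.face d) - y (P.face d.symm)) ^ 2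
        = ∑ d, (g d * y (P.face d) + g d.symm * y (P.face d.symm) -
          (x d.snd - x d.fst) * (y (P.face d) - y (P.face d.symm))) :=
        Finset.sum_congr rfl fun d _ => by
          rw [hg]
          linear_combination -(y (P.face d) - y (P.face d.symm)) * hy d
      _ = 0 := by rw [Finset.sum_sub_distrib, Finset.sum_add_distrib, h2, h1, h3]; simp
  rw [Finset.sum_eq_zero_iff_of_nonneg (fun _ _ => sq_nonneg _)] at h4
  refine ⟨x, fun d => ?_⟩
  have h5 := pow_eq_zero_iff two_ne_zero |>.1 (h4 d (Finset.mem_univ d))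
  linarith [hy d]

-- The dual of `exists_vertex_potential`, with vertex sums in place of face sums.
open Classical in
theorem exists_face_potential_real {g : P.graph.Dart → ℝ} (hg : ∀ d, g d.symm = -g d)
    (hV : ∀ v, ∑ d with d.fst = v, g d = 0) :
    ∃ y : P.Face → ℝ, ∀ d, g d = y (P.face d) - y (P.face d.symm) := by
  obtain ⟨s, x, y, h⟩ := P.exists_decomposition g
  have hs : ∀ d : P.graph.Dart, s ⟨d.edge, d.edge_mem⟩ = 0 := fun d => by
    have h1 := h d
    have h2 := h d.symm
    rw [hg] at h2
    simp only [SimpleGraph.Dart.edge_symm, SimpleGraph.Dart.symm_symm] at h2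
    simp only [SimpleGraph.Dart.symm, Prod.fst_swap, Prod.snd_swap] at h1 h2
    linarith
  have hx : ∀ d, g d - (y (P.face d) - y (P.face d.symm)) = x d.snd - x d.fst := fun d => by
    rw [h d, hs d]; ring
  have h1 : ∑ d : P.graph.Dart, g d * x d.fst = 0 := by
    rw [← Finset.sum_fiberwise (s := Finset.univ) (g := fun d : P.graph.Dart => d.fst)]
    refine Finset.sum_eq_zero fun v _ => ?_
    rw [Finset.sum_congr rfl (g := fun d => g d * x v)
      (fun d hd => by rw [(Finset.mem_filter.1 hd).2]), ← Finset.sum_mul, hV, zero_mul]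
  have h2 := P.sum_symm (fun d => g d * x d.fst)
  have h3 := P.sum_coboundary_mul_coboundary x y
  have h4 : ∑ d : P.graph.Dart, (x d.snd - x d.fst) ^ 2 = 0 := by
    calc ∑ d : P.graph.Dart, (x d.snd - x d.fst) ^ 2
        = ∑ d : P.graph.Dart, (-(g d.symm * x d.symm.fst) - g d * x d.fst -
          (x d.snd - x d.fst) * (y (P.face d) - y (P.face d.symm))) :=
        Finset.sum_congr rfl fun d _ => by
          rw [hg]
          simp only [SimpleGraph.Dart.symm, Prod.fst_swap]
          have := hx d
          simp only [SimpleGraph.Dart.symm] at this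
          linear_combination -(x d.snd - x d.fst) * this
      _ = 0 := by
        rw [Finset.sum_sub_distrib, Finset.sum_sub_distrib, Finset.sum_neg_distrib, h2, h1, h3]
        simp
  rw [Finset.sum_eq_zero_iff_of_nonneg (fun _ _ => sq_nonneg _)] at h4
  refine ⟨y, fun d => ?_⟩
  have h5 := pow_eq_zero_iff two_ne_zero |>.1 (h4 d (Finset.mem_univ d))
  linarith [hx d]

open Classical in
theorem exists_face_potential {ι : Type*} {g : P.graph.Dart → ι → ℝ} (hg : ∀ d, g d.symm = -g d)
    (hV : ∀ v, ∑ d with d.fst = v, g d = 0) :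
    ∃ y : P.Face → ι → ℝ, ∀ d, g d = y (P.face d) - y (P.face d.symm) := by
  have : ∀ i, ∃ y : P.Face → ℝ, ∀ d, g d i = y (P.face d) - y (P.face d.symm) := fun i =>
    P.exists_face_potential_real (fun d => congrFun (hg d) i)
      (fun v => by rw [← Finset.sum_apply, hV, Pi.zero_apply])
  choose y hy using this
  exact ⟨fun F i => y i F, fun d => funext fun i => hy i d⟩

/-- A face visits each of its vertices once. -/
theorem eq_of_face_eq_of_fst_eq {d e : P.graph.Dart} (hF : P.face d = P.face e)
    (hv : d.fst = e.fst) : d = e := by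
  classical
  by_contra hde
  -- A discrete Jordan curve argument: a loop through the face that leaves the vertex at one corner
  -- and returns at the other would separate its neighbours. The function `α` is a step function on
  -- the darts around the vertex that jumps at these two corners.
  set f : P.graph.Dart → ℝ := Pi.single d 1 - Pi.single e 1 with hf
  obtain ⟨α, hα⟩ := exists_sub_eq_of_sum_cycle_eq_zero P.rot (fun d => d.fst) P.rot_cycle f (by
    intro c
    simp only [hf, Pi.sub_apply, Finset.sum_sub_distrib, Pi.single_apply, Finset.sum_ite_eq',
      Finset.mem_filter, Finset.mem_univ, true_and, hv, sub_self])
  set g : P.graph.Dart → ℝ := fun c => (if c.fst = d.fst then α c else 0) -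
    (if c.snd = d.fst then α c.symm else 0) with hg
  obtain ⟨x, hx⟩ := P.exists_vertex_potential (g := g) (fun c => by
      simp only [hg, SimpleGraph.Dart.symm_symm]
      exact (neg_sub _ _).symm) (by
    intro F
    have h1 : ∑ c with P.face c = F, g c =
        ∑ c, (if P.face c = F ∧ c.fst = d.fst then α c else 0) -
        ∑ c, (if P.face c = F ∧ c.snd = d.fst then α c.symm else 0) := by
      rw [Finset.sum_filter, ← Finset.sum_sub_distrib]
      refine Finset.sum_congr rfl fun c _ => ?_
      simp only [hg, ite_and]
      split_ifs <;> simp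
    have h2 := P.sum_next (fun c => if P.face c = F ∧ c.fst = d.fst then α (P.rot c) else 0)
    simp only [face_next, next_fst, rot_next] at h2
    rw [h1, h2, ← Finset.sum_sub_distrib]
    -- A passage of a face through the vertex contributes the jump of `α` at that corner. The two
    -- nonzero jumps are opposite and lie in the same face, so all face sums vanish.
    have h3 : ∀ c, ((if P.face c = F ∧ c.fst = d.fst then α c else 0) -
        (if P.face c = F ∧ c.fst = d.fst then α (P.rot c) else 0)) =
        (if c = e then (if P.face e = F then 1 else 0) else 0) -
        (if c = d then (if P.face d = F then 1 else 0) else 0) := by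
      intro c
      have := hα c
      simp only [hf, Pi.sub_apply, Pi.single_apply] at this
      by_cases hcd : c = d
      · subst hcd
        simp only [hde, if_true, if_false, and_true] at this ⊢
        split_ifs <;> linarith
      by_cases hce : c = e
      · subst hce
        simp only [hcd, if_true, if_false, hv, and_true] at this ⊢
        split_ifs <;> linarith
      simp only [hcd, hce, if_false] at this ⊢
      split_ifs <;> linarith
    simp only [h3, Finset.sum_sub_distrib, Finset.sum_ite_eq', Finset.mem_univ, if_true, hF,
      sub_self])
  obtain ⟨w, hw⟩ : ∃ w, w ≠ d.fst := ⟨d.snd, d.fst_ne_snd.symm⟩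
  -- Off the vertex `g` is zero, and the graph stays connected there, so the potential is constant;
  -- then `α` cannot jump.
  have hc : ∀ u, u ≠ d.fst → x u = x w := fun u hu =>
    P.eq_of_forall_adj (s := {d.fst}) (by simp) (fun a b hab ha hb => by
      have := hx ⟨(a, b), hab⟩
      simp only [Finset.mem_singleton] at ha hb
      simp only [hg, ha, hb, if_false, sub_self] at this
      linarith) (by simpa using hu) (by simpa using hw)
  have hαc : ∀ c : P.graph.Dart, c.fst = d.fst → α c = x w - x d.fst := fun c hc' => by
    have h1 := hx c
    have h2 : c.snd ≠ d.fst := fun h => c.fst_ne_snd (hc'.trans h.symm)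
    simp only [hg, hc', h2, if_true, if_false, sub_zero] at h1
    rw [h1, hc _ h2]
  have := hα d
  rw [hαc d rfl, hαc _ (rot_fst d), hf] at this
  simp [hde] at this

/-- If both sides were one face, it would visit the end of `d` along both `P.next d` and `d.symm`;
these would coincide, and the rotation would fix a dart. -/
theorem face_symm_ne (d : P.graph.Dart) : P.face d.symm ≠ P.face d := by
  intro h
  have h1 : P.next d = d.symm := P.eq_of_face_eq_of_fst_eq (by rw [face_next, h]) (next_fst d)
  have h2 := P.rot_next d
  rw [h1] at h2
  exact P.rot_ne_self _ h2

end SphericalPolyhedron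

/-! ### Bar frameworks: virtual work and the dimension of the space of equilibrium loads. -/

namespace Framework

theorem endsLoad_mk {J : Type*} [DecidableEq J] (p : J → Fin 4 → ℝ) (i j : J) :
    endsLoad p s(i, j) = Pi.single i (join (p i) (p j)) + Pi.single j (join (p j) (p i)) := by
  simp only [endsLoad, Sym2.lift_mk]
  congr!

theorem through_endsLoad {J : Type*} (p : J → Fin 4 → ℝ) (e : Sym2 J) (k : J) :
    Through (p k) (endsLoad p e k) := by
  classical
  induction e with
  | _ i j =>
    rw [endsLoad_mk, Pi.add_apply]
    refine .add ?_ ?_ <;> rw [Pi.single_apply] <;> split_ifs with h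
    · subst h; exact .join_left _ _
    · exact .zero _
    · subst h; exact .join_left _ _
    · exact .zero _

theorem sum_endsLoad {J : Type*} [Fintype J] (p : J → Fin 4 → ℝ) (e : Sym2 J) :
    ∑ k, endsLoad p e k = 0 := by
  classical
  induction e with
  | _ i j =>
    simp only [endsLoad_mk, Pi.add_apply, Finset.sum_add_distrib, Finset.sum_pi_single',
      Finset.mem_univ, if_true]
    rw [join_swap (p i), add_neg_cancel]

theorem endsLoad_map_apply {J K : Type*} {p : J → Fin 4 → ℝ} {q : K → Fin 4 → ℝ} {f : J → K}
    (hf : Function.Injective f) (hpq : ∀ i, q (f i) = p i) (e : Sym2 J) (k : J) :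
    endsLoad q (e.map f) (f k) = endsLoad p e k := by
  classical
  induction e with
  | _ i j =>
    simp only [Sym2.map_mk, endsLoad_mk, Pi.add_apply, Pi.single_apply, hf.eq_iff, hpq]

theorem endsLoad_map_apply_of_notMem {J K : Type*} {q : K → Fin 4 → ℝ} {f : J → K} (e : Sym2 J)
    {k : K} (hk : k ∉ Set.range f) : endsLoad q (e.map f) k = 0 := by
  classical
  induction e with
  | _ i j =>
    have : ∀ i, k ≠ f i := fun i h => hk ⟨i, h.symm⟩
    simp only [Sym2.map_mk, endsLoad_mk, Pi.add_apply, Pi.single_apply, this, if_false, add_zero]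

/-- Virtual work: at both ends the motion may be replaced by the common screw `R`, which does no
work on the load of a bar since that load has sum zero. -/
theorem sum_screwPairing_endsLoad {J : Type*} [Fintype J] {p : J → Fin 4 → ℝ} {i j : J}
    {M : J → Fin 6 → ℝ} {R : Fin 6 → ℝ} (hi : Through (p i) (R - M i))
    (hj : Through (p j) (R - M j)) : ∑ k, screwPairing (M k) (endsLoad p s(i, j) k) = 0 := by
  classical
  have h1 := hi.screwPairing_eq_zero (.join_left (p i) (p j))
  have h2 := hj.screwPairing_eq_zero (.join_right (p i) (p j))
  rw [map_sub, LinearMap.sub_apply] at h1 h2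
  simp only [endsLoad_mk, Pi.add_apply, map_add, Finset.sum_add_distrib]
  rw [Finset.sum_eq_single i, Finset.sum_eq_single j, Pi.single_eq_same, Pi.single_eq_same,
    join_swap (p i) (p j), map_neg]
  · linarith
  all_goals simp +contextual

variable {J B : Type*} (X : Framework J B)

/-- The total of a load. -/
def totalLoad [Fintype J] : (∀ i, throughSubmodule (X.pos i)) →ₗ[ℝ] (Fin 6 → ℝ) :=
  ∑ i, (throughSubmodule (X.pos i)).subtype ∘ₗ LinearMap.proj i

theorem totalLoad_apply [Fintype J] (L : ∀ i, throughSubmodule (X.pos i)) :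
    X.totalLoad L = ∑ i, (L i : Fin 6 → ℝ) := by
  simp [totalLoad]

/-- If screws do no work on the equilibrium loads, they are the motion of one screw. -/
theorem exists_screw_of_forall_equilibriumLoad [Fintype J] (hpos : ∀ i, X.pos i ≠ 0)
    {M : J → Fin 6 → ℝ}
    (hM : ∀ L, X.IsEquilibriumLoad L → ∑ i, screwPairing (M i) (L i) = 0) :
    ∃ T, ∀ i, Through (X.pos i) (M i - T) := by
  classical
  -- The work of the motion vanishes on loads with total zero, so it factors through the total. The
  -- factor is the pairing with a screw `T`, and loads at a single joint compare `M i` with `T`.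
  let W : (∀ i, throughSubmodule (X.pos i)) →ₗ[ℝ] ℝ :=
    ∑ i, screwPairing (M i) ∘ₗ (throughSubmodule (X.pos i)).subtype ∘ₗ LinearMap.proj i
  have hW : ∀ L, W L = ∑ i, screwPairing (M i) (L i) := fun L => by simp [W]
  have hker : W ∈ LinearMap.range X.totalLoad.dualMap := by
    rw [LinearMap.range_dualMap_eq_dualAnnihilator_ker, Submodule.mem_dualAnnihilator]
    intro L hL
    rw [LinearMap.mem_ker, totalLoad_apply] at hL
    rw [hW]
    exact hM (fun i => L i) ⟨fun i => mem_throughSubmodule.1 (L i).2, hL⟩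
  obtain ⟨φ, hφ⟩ := hker
  have hφ' : ∀ L, φ (X.totalLoad L) = W L := fun L => LinearMap.congr_fun hφ L
  obtain ⟨T, hT⟩ := exists_screwPairing_eq φ
  refine ⟨T, fun i => through_of_screwPairing_eq_zero (hpos i) fun L hL => ?_⟩
  have h := hφ' (Pi.single i ⟨L, mem_throughSubmodule.2 hL⟩)
  have h1 : ∀ k, ((Pi.single i ⟨L, mem_throughSubmodule.2 hL⟩ : ∀ i, throughSubmodule (X.pos i)) k :
      Fin 6 → ℝ) = if k = i then L else 0 := by
    intro k
    by_cases hk : k = i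
    · subst hk; simp
    · simp [hk]
  rw [hT, totalLoad_apply, hW] at h
  simp only [h1, Finset.sum_ite_eq', Finset.mem_univ, if_true] at h
  rw [Finset.sum_eq_single i (by simp +contextual) (by simp)] at h
  rw [map_sub, LinearMap.sub_apply, h]
  simp

theorem StaticallyRigid.exists_screw [Fintype J] [Fintype B] (h : X.StaticallyRigid)
    (hpos : ∀ i, X.pos i ≠ 0) {M : J → Fin 6 → ℝ}
    (hM : ∀ b, ∑ i, screwPairing (M i) (X.barLoad b i) = 0) :
    ∃ T, ∀ i, Through (X.pos i) (M i - T) := by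
  refine X.exists_screw_of_forall_equilibriumLoad hpos fun L hL => ?_
  obtain ⟨lam, hlam⟩ := h L hL
  have : ∀ i, L i = -∑ b, lam b • X.barLoad b i := fun i => eq_neg_of_add_eq_zero_left (hlam i)
  simp only [this, map_neg, map_sum, map_smul, Finset.sum_neg_distrib]
  rw [Finset.sum_comm, neg_eq_zero]
  exact Finset.sum_eq_zero fun b _ => by rw [← Finset.smul_sum, hM, smul_zero]

/-- Each joint carries three dimensions of loads. The total reaches all six dimensions, because a
functional that vanishes on the totals is a screw fixing every joint. -/
theorem finrank_ker_totalLoad [Fintype J] (hpos : ∀ i, X.pos i ≠ 0)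
    (hspan : ∀ T, (∀ i, Through (X.pos i) T) → T = 0) :
    Module.finrank ℝ (LinearMap.ker X.totalLoad) + 6 = 3 * Fintype.card J := by
  classical
  have hsurj : LinearMap.range X.totalLoad = ⊤ := by
    by_contra hne
    obtain ⟨φ, hφ0, hφ⟩ := Submodule.exists_le_ker_of_lt_top _ (lt_top_iff_ne_top.2 hne)
    obtain ⟨T, hT⟩ := exists_screwPairing_eq φ
    apply hφ0
    have : T = 0 := hspan T fun i => through_of_screwPairing_eq_zero (hpos i) fun L hL => by
      have h := hφ ⟨Pi.single i ⟨L, mem_throughSubmodule.2 hL⟩, rfl⟩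
      rw [LinearMap.mem_ker, hT, totalLoad_apply,
        Finset.sum_eq_single i (by simp +contextual) (by simp)] at h
      simpa using h
    ext L
    simp [hT, this]
  have h := LinearMap.finrank_range_add_finrank_ker X.totalLoad
  rw [hsurj, finrank_top, Module.finrank_pi_fintype ℝ (M := fun i => throughSubmodule (X.pos i)),
    Finset.sum_congr rfl fun i _ => finrank_throughSubmodule (hpos i)] at h
  simp only [Finset.sum_const, Finset.card_univ, Module.finrank_fintype_fun_eq_card,
    Fintype.card_fin, smul_eq_mul] at h
  omega

/-- The space of equilibrium loads. -/
def equilibriumLoads [Fintype J] : Submodule ℝ (J → Fin 6 → ℝ) :=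
  (LinearMap.ker X.totalLoad).map
    (LinearMap.pi fun i => (throughSubmodule (X.pos i)).subtype ∘ₗ LinearMap.proj i)

theorem mem_equilibriumLoads [Fintype J] {L : J → Fin 6 → ℝ} :
    L ∈ X.equilibriumLoads ↔ X.IsEquilibriumLoad L := by
  constructor
  · rintro ⟨L, hL, rfl⟩
    rw [SetLike.mem_coe, LinearMap.mem_ker, totalLoad_apply] at hL
    exact ⟨fun i => mem_throughSubmodule.1 (L i).2, hL⟩
  · intro h
    refine ⟨fun i => ⟨L i, mem_throughSubmodule.2 (h.1 i)⟩, ?_, rfl⟩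
    rw [SetLike.mem_coe, LinearMap.mem_ker, totalLoad_apply]
    exact h.2

theorem finrank_equilibriumLoads [Fintype J] (hpos : ∀ i, X.pos i ≠ 0)
    (hspan : ∀ T, (∀ i, Through (X.pos i) T) → T = 0) :
    Module.finrank ℝ X.equilibriumLoads + 6 = 3 * Fintype.card J := by
  rw [← X.finrank_ker_totalLoad hpos hspan, equilibriumLoads, ← LinearEquiv.finrank_eq
    (Submodule.equivMapOfInjective _ (fun L K h => funext fun i => Subtype.ext (congrFun h i)) _)]

/-- The combinations of the bar loads. -/
noncomputable def barCombination [Fintype B] : (B → ℝ) →ₗ[ℝ] (J → Fin 6 → ℝ) where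
  toFun lam i := ∑ b, lam b • X.barLoad b i
  map_add' a b := by
    ext i : 1
    simp [add_smul, Finset.sum_add_distrib]
  map_smul' c a := by
    ext i : 1
    simp [mul_smul, Finset.smul_sum]

theorem barCombination_apply [Fintype B] (lam : B → ℝ) (i : J) :
    X.barCombination lam i = ∑ b, lam b • X.barLoad b i := rfl

theorem independent_iff_injective [Fintype B] :
    X.Independent ↔ Function.Injective X.barCombination := by
  rw [injective_iff_map_eq_zero]
  exact forall_congr' fun lam => imp_congr (by rw [funext_iff]; rfl) Iff.rfl

theorem range_barCombination_le [Fintype J] [Fintype B] :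
    LinearMap.range X.barCombination ≤ X.equilibriumLoads := by
  rintro _ ⟨lam, rfl⟩
  refine X.mem_equilibriumLoads.2 ⟨fun i => .sum fun b _ => (through_endsLoad _ _ _).smul _, ?_⟩
  simp only [barCombination_apply]
  rw [Finset.sum_comm]
  simp only [← Finset.smul_sum, barLoad, sum_endsLoad, smul_zero, Finset.sum_const_zero]

theorem staticallyRigid_iff_range_eq [Fintype J] [Fintype B] :
    X.StaticallyRigid ↔ LinearMap.range X.barCombination = X.equilibriumLoads := by
  refine ⟨fun h => le_antisymm X.range_barCombination_le fun L hL => ?_, fun h L hL => ?_⟩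
  · obtain ⟨lam, hlam⟩ := h L (X.mem_equilibriumLoads.1 hL)
    refine ⟨-lam, funext fun i => ?_⟩
    rw [barCombination_apply, eq_neg_of_add_eq_zero_left (hlam i)]
    simp
  · rw [← X.mem_equilibriumLoads, ← h] at hL
    obtain ⟨lam, rfl⟩ := hL
    refine ⟨-lam, fun i => ?_⟩
    rw [barCombination_apply]
    simp

theorem Isostatic.card_add_six [Fintype J] [Fintype B] (h : X.Isostatic)
    (hpos : ∀ i, X.pos i ≠ 0) (hspan : ∀ T, (∀ i, Through (X.pos i) T) → T = 0) :
    Fintype.card B + 6 = 3 * Fintype.card J := by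
  rw [← X.finrank_equilibriumLoads hpos hspan, ← X.staticallyRigid_iff_range_eq.1 h.2,
    LinearMap.finrank_range_of_inj (X.independent_iff_injective.1 h.1)]
  simp

theorem Independent.isostatic [Fintype J] [Fintype B] (h : X.Independent)
    (hpos : ∀ i, X.pos i ≠ 0) (hspan : ∀ T, (∀ i, Through (X.pos i) T) → T = 0)
    (hcard : Fintype.card B + 6 = 3 * Fintype.card J) : X.Isostatic := by
  refine ⟨h, X.staticallyRigid_iff_range_eq.2
    (Submodule.eq_of_le_of_finrank_eq X.range_barCombination_le ?_)⟩
  have := X.finrank_equilibriumLoads hpos hspan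
  rw [LinearMap.finrank_range_of_inj (X.independent_iff_injective.1 h),
    Module.finrank_fintype_fun_eq_card]
  omega

theorem isostatic_comp_equiv [Fintype J] [Fintype B] {C : Type*} [Fintype C] (σ : C ≃ B)
    (h : X.Isostatic) : (Framework.mk (fun c => X.ends (σ c)) X.pos).Isostatic := by
  set Y := Framework.mk (fun c => X.ends (σ c)) X.pos
  have hload : ∀ c, Y.barLoad c = X.barLoad (σ c) := fun c => rfl
  have hsum : ∀ (lam : C → ℝ) i, ∑ c, lam c • Y.barLoad c i =
      ∑ b, lam (σ.symm b) • X.barLoad b i := fun lam i => by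
    rw [← Equiv.sum_comp σ]
    simp [hload]
  constructor
  · intro lam hlam
    have := h.1 (lam ∘ σ.symm) fun i => by
      rw [← hlam i, hsum]; rfl
    funext c
    simpa using congrFun this (σ c)
  · intro L hL
    obtain ⟨lam, hlam⟩ := h.2 L hL
    refine ⟨lam ∘ σ, fun i => ?_⟩
    rw [hsum]
    simpa using hlam i

end Framework

/-! ### Boundary polygons and the frames of blocks. -/

namespace SphericalPolyhedron

variable {V : Type*} [Fintype V] {P : SphericalPolyhedron V}

noncomputable instance (F : P.Face) : Fintype {v : V // P.OnFace F v} := Fintype.ofFinite _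

noncomputable instance (F : P.Face) : Fintype {d : P.graph.Dart // P.face d = F} :=
  Fintype.ofFinite _

theorem onFace_fst (d : P.graph.Dart) : P.OnFace (P.face d) d.fst := ⟨d, rfl, rfl⟩

theorem onFace_snd (d : P.graph.Dart) : P.OnFace (P.face d) d.snd :=
  ⟨P.next d, face_next d, next_fst d⟩

/-- The vertices of a face correspond to the darts of its boundary. -/
noncomputable def faceDartEquiv (F : P.Face) :
    {d : P.graph.Dart // P.face d = F} ≃ {v : V // P.OnFace F v} :=
  Equiv.ofBijective (fun d => ⟨d.1.fst, d.1, d.2, rfl⟩)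
    ⟨fun d e h => Subtype.ext (P.eq_of_face_eq_of_fst_eq (d.2.trans e.2.symm)
      (congrArg Subtype.val h)), fun ⟨_, d, hF, hd⟩ => ⟨⟨d, hF⟩, Subtype.ext hd⟩⟩

/-- The edge of a dart of a face, as an edge of the boundary polygon. -/
def polygonEdge {F : P.Face} (n : ℕ) (d : {d : P.graph.Dart // P.face d = F}) :
    Sym2 ({v : V // P.OnFace F v} ⊕ Fin n) :=
  s(Sum.inl ⟨d.1.fst, d.1, d.2, rfl⟩, Sum.inl ⟨d.1.snd, P.next d.1, (face_next d.1).trans d.2,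
    next_fst d.1⟩)

theorem polygonEdge_mem {F : P.Face} {n : ℕ} (d : {d : P.graph.Dart // P.face d = F}) :
    polygonEdge n d ∈ (P.polygon F n).edgeSet :=
  ⟨_, _, rfl, rfl, d.1, d.2, rfl⟩

/-- A face visits each vertex once and lies on only one side of each of its edges. -/
theorem polygonEdge_injective {F : P.Face} {n : ℕ} :
    Function.Injective (polygonEdge (F := F) n) := by
  rintro ⟨d, hd⟩ ⟨e, he⟩ h
  simp only [polygonEdge, Sym2.eq_iff, Sum.inl.injEq, Subtype.ext_iff] at h
  obtain ⟨h1, -⟩ | ⟨h1, h2⟩ := h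
  · exact Subtype.ext (P.eq_of_face_eq_of_fst_eq (hd.trans he.symm) h1)
  · have : d.symm = e := SimpleGraph.Dart.ext _ _ (Prod.ext h2 h1)
    exact absurd (by rw [this, hd, he]) (P.face_symm_ne d)

theorem exists_polygonEdge_eq {F : P.Face} {n : ℕ} {e : Sym2 ({v : V // P.OnFace F v} ⊕ Fin n)}
    (he : e ∈ (P.polygon F n).edgeSet) : ∃ d, polygonEdge n d = e := by
  induction e with
  | _ x y =>
    obtain ⟨u, v, rfl, rfl, d, hd, h⟩ := he
    refine ⟨⟨d, hd⟩, ?_⟩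
    simp only [polygonEdge, Sym2.eq_iff, Sum.inl.injEq, Subtype.ext_iff]
    exact Sym2.eq_iff.1 h

theorem sum_card_face (P : SphericalPolyhedron V) :
    ∑ F : P.Face, Fintype.card {d : P.graph.Dart // P.face d = F} = 2 * Nat.card P.graph.edgeSet := by
  classical
  rw [← card_dart, ← Fintype.card_sigma]
  exact Fintype.card_congr (Equiv.sigmaFiberEquiv P.face)

namespace BlockFrame

variable {p : V → Fin 4 → ℝ} {F : P.Face} (I : P.BlockFrame p F)

/-- The bars of the framework of a block: the darts of the boundary and the added edges. -/
noncomputable def barEquiv : {d : P.graph.Dart // P.face d = F} ⊕ I.added.edgeSet ≃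
    (P.polygon F I.n ⊔ I.added).edgeSet :=
  Equiv.ofBijective (Sum.elim
    (fun d => ⟨polygonEdge I.n d, by rw [SimpleGraph.edgeSet_sup]; exact .inl (polygonEdge_mem d)⟩)
    (fun e => ⟨e.1, by rw [SimpleGraph.edgeSet_sup]; exact .inr e.2⟩)) <| by
    have hdisj := SimpleGraph.disjoint_edgeSet.2 I.added_disjoint
    constructor
    · rintro (d | e) (d' | e') h <;> simp only [Sum.elim_inl, Sum.elim_inr, Subtype.mk.injEq] at h
      · rw [polygonEdge_injective h]
      · exact absurd (h ▸ e'.2) (Set.disjoint_left.1 hdisj (polygonEdge_mem d))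
      · exact absurd (h ▸ e.2) (Set.disjoint_left.1 hdisj (polygonEdge_mem d'))
      · rw [Subtype.ext h]
    · rintro ⟨e, he⟩
      rw [SimpleGraph.edgeSet_sup] at he
      rcases he with he | he
      · obtain ⟨d, rfl⟩ := exists_polygonEdge_eq he
        exact ⟨.inl d, rfl⟩
      · exact ⟨.inr ⟨e, he⟩, rfl⟩

/-- The framework of a block, with its bars indexed by the darts of the boundary and the added
edges. -/
def framework : Framework ({v : V // P.OnFace F v} ⊕ Fin I.n)
    ({d : P.graph.Dart // P.face d = F} ⊕ I.added.edgeSet) where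
  ends := Sum.elim (polygonEdge I.n) Subtype.val
  pos := Sum.elim (fun v => p v.1) I.pos

theorem framework_isostatic : I.framework.Isostatic := by
  have h := (Framework.isostatic_comp_equiv _ I.barEquiv I.isostatic)
  have e : I.framework.ends = fun b => (I.barEquiv b).1 := by
    funext b
    rcases b with d | e <;> rfl
  change (Framework.mk I.framework.ends I.framework.pos).Isostatic
  rw [e]
  exact h

/-- The load of a combination of the added edges. -/
noncomputable def load (mu : I.added.edgeSet → ℝ) (k : V ⊕ Fin I.n) : Fin 6 → ℝ :=
  ∑ e, mu e • Framework.endsLoad (Sum.elim p I.pos) (e.1.map (Sum.map Subtype.val id)) k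

theorem map_injective : Function.Injective
    (Sum.map Subtype.val id : {v : V // P.OnFace F v} ⊕ Fin I.n → V ⊕ Fin I.n) :=
  Sum.map_injective.2 ⟨Subtype.val_injective, Function.injective_id⟩

theorem elim_map (k : {v : V // P.OnFace F v} ⊕ Fin I.n) :
    Sum.elim p I.pos (Sum.map Subtype.val id k) = I.framework.pos k := by
  rcases k with k | k <;> rfl

theorem load_inl_of_not_onFace (mu : I.added.edgeSet → ℝ) {v : V} (hv : ¬ P.OnFace F v) :
    I.load mu (.inl v) = 0 :=
  Finset.sum_eq_zero fun e _ => by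
    rw [Framework.endsLoad_map_apply_of_notMem, smul_zero]
    rintro ⟨w | w, hw⟩
    · obtain rfl := Sum.inl_injective hw
      exact hv w.2
    · cases hw

theorem through_load (mu : I.added.edgeSet → ℝ) (v : V) : Through (p v) (I.load mu (.inl v)) :=
  .sum fun _ _ => (Framework.through_endsLoad (Sum.elim p I.pos) _ (.inl v)).smul _

theorem sum_load (mu : I.added.edgeSet → ℝ) (h : ∀ j, I.load mu (.inr j) = 0) :
    ∑ v, I.load mu (.inl v) = 0 := by
  have h1 : ∑ k, I.load mu k = 0 := by
    simp only [load]
    rw [Finset.sum_comm]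
    simp only [← Finset.smul_sum, Framework.sum_endsLoad, smul_zero, Finset.sum_const_zero]
  rw [Fintype.sum_sum_type] at h1
  simpa [h] using h1

theorem endsLoad_polygonEdge (d : {d : P.graph.Dart // P.face d = F})
    (k : {v : V // P.OnFace F v} ⊕ Fin I.n) :
    Framework.endsLoad I.framework.pos (polygonEdge I.n d) k =
      Sum.elim (fun v => Framework.endsLoad p d.1.edge v.1) 0 k := by
  have h1 : (polygonEdge I.n d).map (Sum.map Subtype.val id) = d.1.edge.map Sum.inl := rfl
  rw [← Framework.endsLoad_map_apply (q := Sum.elim p I.pos) I.map_injective I.elim_map, h1]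
  rcases k with v | j
  · exact Framework.endsLoad_map_apply (p := p) Sum.inl_injective (fun _ => rfl) _ v.1
  · exact Framework.endsLoad_map_apply_of_notMem _ (by rintro ⟨w, hw⟩; cases hw)

theorem sum_barLoad (lam : {d : P.graph.Dart // P.face d = F} ⊕ I.added.edgeSet → ℝ)
    (k : {v : V // P.OnFace F v} ⊕ Fin I.n) : ∑ b, lam b • I.framework.barLoad b k =
      Sum.elim (fun v => ∑ d, lam (.inl d) • Framework.endsLoad p d.1.edge v.1) 0 k +
        I.load (fun e => lam (.inr e)) (Sum.map Subtype.val id k) := by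
  rw [Fintype.sum_sum_type]
  have h1 : ∀ d, I.framework.barLoad (.inl d) k =
    Sum.elim (fun v => Framework.endsLoad p d.1.edge v.1) 0 k := fun d => I.endsLoad_polygonEdge d k
  have h2 : ∀ e, I.framework.barLoad (.inr e) k = Framework.endsLoad (Sum.elim p I.pos)
      (e.1.map (Sum.map Subtype.val id)) (Sum.map Subtype.val id k) := fun e =>
    (Framework.endsLoad_map_apply I.map_injective I.elim_map _ _).symm
  simp only [h1, h2, load]
  congr 1
  rcases k with v | j <;> simp

theorem endsLoad_edge_of_not_onFace (d : {d : P.graph.Dart // P.face d = F}) {v : V}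
    (hv : ¬ P.OnFace F v) : Framework.endsLoad p d.1.edge v = 0 := by
  classical
  obtain ⟨d, rfl⟩ := d
  have h1 : v ≠ d.fst := fun h => hv (h ▸ onFace_fst d)
  have h2 : v ≠ d.snd := fun h => hv (h ▸ onFace_snd d)
  have : d.edge = s(d.fst, d.snd) := rfl
  rw [this, Framework.endsLoad_mk]
  simp [h1, h2]

theorem independent {c : {d : P.graph.Dart // P.face d = F} → ℝ} {mu : I.added.edgeSet → ℝ}
    (h1 : ∀ v, ∑ d, c d • Framework.endsLoad p d.1.edge v + I.load mu (.inl v) = 0)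
    (h2 : ∀ j, I.load mu (.inr j) = 0) : c = 0 ∧ mu = 0 := by
  have := I.framework_isostatic.1 (Sum.elim c mu) fun k => by
    rw [sum_barLoad]
    rcases k with v | j
    · exact h1 v.1
    · simpa using h2 j
  exact ⟨funext fun d => congrFun this (.inl d), funext fun e => congrFun this (.inr e)⟩

theorem resolve {L : V → Fin 6 → ℝ} (hL : ∀ v, Through (p v) (L v)) (hsum : ∑ v, L v = 0)
    (hoff : ∀ v, ¬ P.OnFace F v → L v = 0) :
    ∃ (c : {d : P.graph.Dart // P.face d = F} → ℝ) (mu : I.added.edgeSet → ℝ),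
      (∀ v, L v + (∑ d, c d • Framework.endsLoad p d.1.edge v + I.load mu (.inl v)) = 0) ∧
      ∀ j, I.load mu (.inr j) = 0 := by
  classical
  obtain ⟨lam, hlam⟩ := I.framework_isostatic.2 (Sum.elim (fun v => L v.1) 0) ⟨by
    rintro (v | j)
    · exact hL v.1
    · exact .zero _, by
    rw [Fintype.sum_sum_type]
    simp only [Sum.elim_inl, Sum.elim_inr, Pi.zero_apply, Finset.sum_const_zero, add_zero]
    rw [← Fintype.sum_subtype_add_sum_subtype (P.OnFace F) L,
      Fintype.sum_eq_zero _ fun v : {v // ¬ P.OnFace F v} => hoff v.1 v.2, add_zero] at hsum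
    rw [← hsum]
    congr!⟩
  refine ⟨fun d => lam (.inl d), fun e => lam (.inr e), fun v => ?_, fun j => ?_⟩
  · by_cases hv : P.OnFace F v
    · have := hlam (.inl ⟨v, hv⟩)
      rw [sum_barLoad] at this
      exact this
    · rw [hoff v hv, I.load_inl_of_not_onFace _ hv, Finset.sum_eq_zero fun d _ => by
        rw [endsLoad_edge_of_not_onFace d hv, smul_zero]]
      simp
  · have := hlam (.inr j)
    rw [sum_barLoad] at this
    simpa using this

/-- The isostatic count of the frame, for a polygon with as many edges as vertices. -/
theorem card_added_add_six (hp : P.IsConfiguration p) (hF : ¬ P.CollinearFace p F) :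
    Fintype.card I.added.edgeSet + 6 =
      2 * Fintype.card {d : P.graph.Dart // P.face d = F} + 3 * I.n := by
  have h := Framework.Isostatic.card_add_six _ I.framework_isostatic (by
    rintro (v | j)
    · obtain ⟨d, hd⟩ := P.exists_dart v.1
      have := (hp _ _ d.adj).ne_zero 0
      change p v.1 ≠ 0
      rw [← hd]
      exact this
    · exact I.pos_ne_zero j) fun T hT =>
    eq_zero_of_forall_through hF fun v hv => hT (.inl ⟨v, hv⟩)
  rw [Fintype.card_sum, Fintype.card_sum, Fintype.card_fin,
    ← Fintype.card_congr (faceDartEquiv F)] at h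
  omega

end BlockFrame

end SphericalPolyhedron

/-! ### The equilibrium equations of the static framework, separated by blocks. -/

namespace BlockHolePolyhedron

variable {V : Type*} [Fintype V] (P : BlockHolePolyhedron V)

variable {P} in
theorem staticFramework_barLoad_inr {p : V → Fin 4 → ℝ} (I : P.BlockFilling p) (F : P.Block)
    (e : (I F).added.edgeSet) (k : V ⊕ Fin (I F).n) :
    (P.staticFramework p I).barLoad (.inr ⟨F, e⟩) (Sum.map id (fun j => ⟨F, j⟩) k) =
      Framework.endsLoad (Sum.elim p (I F).pos) (e.1.map (Sum.map Subtype.val id)) k := by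
  rw [← Framework.endsLoad_map_apply (q := (P.staticFramework p I).pos)
    (f := Sum.map id fun j => (⟨F, j⟩ : Σ F : P.Block, Fin (I F).n))
    (Sum.map_injective.2 ⟨Function.injective_id, fun _ _ h => by simpa using h⟩)
    (by rintro (v | j) <;> rfl), Sym2.map_map, Sum.map_comp_map]
  rfl

theorem staticFramework_sum_inl {p : V → Fin 4 → ℝ} (I : P.BlockFilling p)
    (lam : P.graph.edgeSet ⊕ (Σ F : P.Block, (I F).added.edgeSet) → ℝ) (v : V) :
    ∑ b, lam b • (P.staticFramework p I).barLoad b (.inl v) =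
      ∑ e : P.graph.edgeSet, lam (.inl e) • Framework.endsLoad p e.1 v +
        ∑ F, (I F).load (fun e => lam (.inr ⟨F, e⟩)) (.inl v) := by
  rw [Fintype.sum_sum_type, Fintype.sum_sigma]
  congr 1
  · refine Finset.sum_congr rfl fun e _ => ?_
    congr 1
    exact Framework.endsLoad_map_apply (p := p) Sum.inl_injective (fun _ => rfl) _ v
  · refine Finset.sum_congr rfl fun F _ => Finset.sum_congr rfl fun e _ => ?_
    congr 1
    exact staticFramework_barLoad_inr I F e (.inl v)

theorem staticFramework_sum_inr {p : V → Fin 4 → ℝ} (I : P.BlockFilling p)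
    (lam : P.graph.edgeSet ⊕ (Σ F : P.Block, (I F).added.edgeSet) → ℝ) (F : P.Block)
    (j : Fin (I F).n) : ∑ b, lam b • (P.staticFramework p I).barLoad b (.inr ⟨F, j⟩) =
      (I F).load (fun e => lam (.inr ⟨F, e⟩)) (.inr j) := by
  rw [Fintype.sum_sum_type, Fintype.sum_sigma, Finset.sum_eq_zero fun e _ => ?_, zero_add,
    Finset.sum_eq_single F (fun G _ hG => Finset.sum_eq_zero fun e _ => ?_) (by simp)]
  · refine Finset.sum_congr rfl fun e _ => ?_
    congr 1
    exact staticFramework_barLoad_inr I F e (.inr j)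
  · have : (P.staticFramework p I).barLoad (.inr ⟨G, e⟩) (.inr ⟨F, j⟩) = 0 :=
      Framework.endsLoad_map_apply_of_notMem _ (by
        rintro ⟨w | w, hw⟩
        · cases hw
        · exact hG (congrArg Sigma.fst (Sum.inr_injective hw)))
    rw [this, smul_zero]
  · have : (P.staticFramework p I).barLoad (.inl e) (.inr ⟨F, j⟩) = 0 :=
      Framework.endsLoad_map_apply_of_notMem _ (by rintro ⟨w, hw⟩; cases hw)
    rw [this, smul_zero]

theorem staticFramework_isSelfStress_iff {p : V → Fin 4 → ℝ} (I : P.BlockFilling p)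
    (lam : P.graph.edgeSet ⊕ (Σ F : P.Block, (I F).added.edgeSet) → ℝ) :
    (P.staticFramework p I).IsSelfStress lam ↔
      (∀ v, ∑ e : P.graph.edgeSet, lam (.inl e) • Framework.endsLoad p e.1 v +
        ∑ F, (I F).load (fun e => lam (.inr ⟨F, e⟩)) (.inl v) = 0) ∧
      ∀ F j, (I F).load (fun e => lam (.inr ⟨F, e⟩)) (.inr j) = 0 := by
  simp only [← staticFramework_sum_inl, ← staticFramework_sum_inr]
  exact ⟨fun h => ⟨fun v => h _, fun F j => h _⟩, fun h k => by
    rcases k with v | ⟨F, j⟩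
    exacts [h.1 v, h.2 F j]⟩

end BlockHolePolyhedron

/-! ### Sums over darts, corners and edges. -/

namespace SphericalPolyhedron

variable {V : Type*} [Fintype V] {P : SphericalPolyhedron V}

/-- The edge of a dart. -/
def dartEdge (d : P.graph.Dart) : P.graph.edgeSet := ⟨d.edge, d.edge_mem⟩

theorem dartEdge_symm (d : P.graph.Dart) : dartEdge d.symm = dartEdge d :=
  Subtype.ext d.edge_symm

theorem exists_dartEdge_eq (e : P.graph.edgeSet) : ∃ d : P.graph.Dart, dartEdge d = e := by
  obtain ⟨e, he⟩ := e
  induction e with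
  | _ a b => exact ⟨⟨(a, b), he⟩, rfl⟩

theorem dartEdge_eq_iff {d e : P.graph.Dart} : dartEdge d = dartEdge e ↔ d = e ∨ d = e.symm := by
  rw [← SimpleGraph.dart_edge_eq_iff]
  exact Subtype.ext_iff

/-- The 2-extensor of a dart. -/
def dartJoin (p : V → Fin 4 → ℝ) (d : P.graph.Dart) : Fin 6 → ℝ := join (p d.fst) (p d.snd)

theorem dartJoin_symm (p : V → Fin 4 → ℝ) (d : P.graph.Dart) :
    dartJoin p d.symm = -dartJoin p d := join_swap _ _

theorem through_fst_dartJoin (p : V → Fin 4 → ℝ) (d : P.graph.Dart) :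
    Through (p d.fst) (dartJoin p d) := .join_left _ _

theorem through_snd_dartJoin (p : V → Fin 4 → ℝ) (d : P.graph.Dart) :
    Through (p d.snd) (dartJoin p d) := .join_right _ _

theorem IsConfiguration.dartJoin_ne_zero {p : V → Fin 4 → ℝ} (hp : P.IsConfiguration p)
    (d : P.graph.Dart) : dartJoin p d ≠ 0 :=
  fun h => not_linearIndependent_of_join_eq_zero h (hp _ _ d.adj)

theorem IsConfiguration.ne_zero {p : V → Fin 4 → ℝ} (hp : P.IsConfiguration p) (v : V) :
    p v ≠ 0 := by
  obtain ⟨d, rfl⟩ := P.exists_dart v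
  exact (hp _ _ d.adj).ne_zero 0

theorem eq_of_face_eq {α : Type*} {h : P.graph.Dart → α} {F : P.Face}
    (hF : ∀ d, P.face d = F → h (P.next d) = h d) {d e : P.graph.Dart} (hd : P.face d = F)
    (he : P.face e = F) : h d = h e := by
  obtain ⟨n, -, -, rfl⟩ := (face_eq_iff.1 (hd.trans he.symm)).exists_pow_eq''
  clear he
  have key : ∀ n : ℕ, P.face ((P.next ^ n) d) = F ∧ h d = h ((P.next ^ n) d) := by
    intro n
    induction n with
    | zero => exact ⟨hd, rfl⟩
    | succ n ih =>
      rw [pow_succ', Equiv.Perm.mul_apply, face_next]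
      exact ⟨ih.1, ih.2.trans (hF _ ih.1).symm⟩
  exact (key n).2

theorem through_of_rot {p : V → Fin 4 → ℝ} {Q : P.graph.Dart → Fin 6 → ℝ}
    (hQ : ∀ d, Through (p d.fst) (Q (P.rot d) - Q d)) {d e : P.graph.Dart} (h : d.fst = e.fst) :
    Through (p d.fst) (Q d - Q e) := by
  obtain ⟨n, -, -, rfl⟩ := ((P.rot_cycle d e).2 h).exists_pow_eq''
  clear h
  have key : ∀ n : ℕ, ((P.rot ^ n) d).fst = d.fst ∧
      Through (p d.fst) (Q d - Q ((P.rot ^ n) d)) := by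
    intro n
    induction n with
    | zero => exact ⟨rfl, by simpa using Through.zero _⟩
    | succ n ih =>
      rw [pow_succ', Equiv.Perm.mul_apply, rot_fst]
      have := hQ ((P.rot ^ n) d)
      rw [ih.1] at this
      exact ⟨ih.1, ih.2.sub_trans this.sub_comm⟩
  exact (key n).2

open Classical in
theorem endsLoad_edge (p : V → Fin 4 → ℝ) (d : P.graph.Dart) (v : V) :
    Framework.endsLoad p d.edge v =
      (if d.fst = v then dartJoin p d else 0) - if d.snd = v then dartJoin p d else 0 := by
  have : d.edge = s(d.fst, d.snd) := rfl
  rw [this, Framework.endsLoad_mk, join_swap (p d.fst)]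
  simp only [Pi.add_apply, Pi.single_apply, dartJoin, eq_comm (a := v)]
  split_ifs <;> simp

open Classical in
theorem sum_smul_endsLoad_fiber (p : V → Fin 4 → ℝ) (c : P.graph.Dart → ℝ) (v : V) :
    ∑ e : P.graph.edgeSet, (∑ d with dartEdge d = e, c d) • Framework.endsLoad p e.1 v =
      ∑ d, c d • Framework.endsLoad p d.edge v := by
  rw [← Finset.sum_fiberwise (s := Finset.univ) (g := dartEdge)
    (f := fun d => c d • Framework.endsLoad p d.edge v)]
  refine Finset.sum_congr rfl fun e _ => ?_
  rw [Finset.sum_smul]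
  refine Finset.sum_congr rfl fun d hd => ?_
  rw [← (Finset.mem_filter.1 hd).2]
  rfl

open Classical in
theorem sum_fiber (c : P.graph.Dart → ℝ) (d : P.graph.Dart) :
    ∑ e with dartEdge e = dartEdge d, c e = c d + c d.symm := by
  have : Finset.univ.filter (fun e => dartEdge e = dartEdge d) = {d, d.symm} := by
    ext e
    simp [dartEdge_eq_iff]
  rw [this, Finset.sum_pair d.symm_ne.symm]

open Classical in
theorem sum_smul_endsLoad (p : V → Fin 4 → ℝ) (w : P.graph.edgeSet → ℝ) (v : V) :
    ∑ e : P.graph.edgeSet, w e • Framework.endsLoad p e.1 v =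
      ∑ d with d.fst = v, w (dartEdge d) • dartJoin p d := by
  -- Each edge shares its scalar equally between its two darts.
  have h1 : ∀ e, w e = ∑ d with dartEdge d = e, w (dartEdge d) / 2 := by
    intro e
    obtain ⟨d, rfl⟩ := P.exists_dartEdge_eq e
    rw [sum_fiber, dartEdge_symm]
    ring
  rw [Finset.sum_congr rfl fun e _ => by rw [h1 e], sum_smul_endsLoad_fiber]
  simp only [endsLoad_edge, smul_sub, Finset.sum_sub_distrib]
  rw [← P.sum_symm (fun d => (w (dartEdge d) / 2) • if d.snd = v then dartJoin p d else 0),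
    ← Finset.sum_sub_distrib, Finset.sum_filter]
  refine Finset.sum_congr rfl fun d _ => ?_
  have : d.symm.snd = d.fst := rfl
  rw [dartEdge_symm, dartJoin_symm, this]
  split_ifs
  · rw [smul_neg, sub_neg_eq_add, ← add_smul, add_halves]
  · simp

open Classical in
theorem sum_face_next {M : Type*} [AddCommMonoid M] (F : P.Face) (f : P.graph.Dart → M) :
    ∑ d with P.face d = F, f (P.next d) = ∑ d with P.face d = F, f d := by
  rw [Finset.sum_filter, Finset.sum_filter,
    ← P.sum_next (fun d => if P.face d = F then f d else 0)]
  simp only [face_next]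

open Classical in
/-- Summation over the vertices of a face. -/
theorem sum_face_snd {M : Type*} [AddCommMonoid M] {F : P.Face} {g : V → M}
    (hg : ∀ v, ¬ P.OnFace F v → g v = 0) : ∑ d with P.face d = F, g d.snd = ∑ v, g v := by
  have h1 : ∑ d with P.face d = F, g d.snd = ∑ d with P.face d = F, g d.fst := by
    rw [← sum_face_next F fun d => g d.fst]
    simp only [next_fst]
  rw [h1, ← Fintype.sum_subtype_add_sum_subtype (P.OnFace F) g,
    Fintype.sum_eq_zero (fun v : {v // ¬ P.OnFace F v} => g v) fun v => hg v.1 v.2, add_zero,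
    Finset.sum_subtype (p := fun d : P.graph.Dart => P.face d = F) _ (by simp)]
  convert Fintype.sum_equiv (faceDartEquiv F) (fun d => g d.1.fst) (fun v => g v.1) fun d => rfl

open Classical in
/-- The load of the boundary polygon of a face at a vertex of the face. -/
theorem sum_face_smul_endsLoad (p : V → Fin 4 → ℝ) (c : P.graph.Dart → ℝ) {F : P.Face}
    {d : P.graph.Dart} (hd : P.face d = F) :
    ∑ e with P.face e = F, c e • Framework.endsLoad p e.edge d.snd =
      c (P.next d) • dartJoin p (P.next d) - c d • dartJoin p d := by
  simp only [endsLoad_edge, smul_sub, Finset.sum_sub_distrib]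
  congr 1
  · rw [Finset.sum_eq_single (P.next d)]
    · rw [if_pos (next_fst d)]
    · intro e he hne
      rw [if_neg, smul_zero]
      intro h
      exact hne (P.eq_of_face_eq_of_fst_eq
        (by rw [face_next, hd, (Finset.mem_filter.1 he).2]) (by rw [next_fst, h]))
    · simp [face_next, hd]
  · rw [Finset.sum_eq_single d]
    · rw [if_pos rfl]
    · intro e he hne
      rw [if_neg, smul_zero]
      intro h
      exact hne (P.next.injective (P.eq_of_face_eq_of_fst_eq
        (by rw [face_next, face_next, hd, (Finset.mem_filter.1 he).2])
        (by rw [next_fst, next_fst, h])))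
    · simp [hd]

-- Corners and edges alternate around `v`, so the changes of `Q` at the corners and across the edges
-- have the same total. This links equilibrium at a vertex with the compatibility of `Q`.
open Classical in
theorem sum_snd_next_sub {M : Type*} [AddCommGroup M] (Q : P.graph.Dart → M) (v : V) :
    ∑ d with d.snd = v, (Q (P.next d) - Q d) = ∑ d with d.fst = v, (Q d - Q d.symm) := by
  rw [Finset.sum_sub_distrib, Finset.sum_sub_distrib]
  congr 1
  · rw [Finset.sum_filter, Finset.sum_filter, ← P.sum_next (fun d => if d.fst = v then Q d else 0)]
    simp only [next_fst]
  · rw [Finset.sum_filter, Finset.sum_filter, ← P.sum_symm]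
    rfl

namespace BlockFrame

variable {p : V → Fin 4 → ℝ} {F : P.Face} (I : P.BlockFrame p F)

open Classical in
theorem eq_zero_of_polygon_add_load_eq_zero {c : P.graph.Dart → ℝ} {mu : I.added.edgeSet → ℝ}
    (h1 : ∀ v, ∑ d with P.face d = F, c d • Framework.endsLoad p d.edge v +
      I.load mu (.inl v) = 0) (h2 : ∀ j, I.load mu (.inr j) = 0) :
    (∀ d, P.face d = F → c d = 0) ∧ mu = 0 := by
  have := I.independent (c := fun d => c d.1) (mu := mu) (fun v => by
    rw [← h1 v, Finset.sum_subtype (p := fun d => P.face d = F) _ (by simp)]) h2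
  exact ⟨fun d hd => congrFun this.1 ⟨d, hd⟩, this.2⟩

open Classical in
theorem exists_polygon_add_load {L : V → Fin 6 → ℝ} (hL : ∀ v, Through (p v) (L v))
    (hsum : ∑ v, L v = 0) (hoff : ∀ v, ¬ P.OnFace F v → L v = 0) :
    ∃ (c : P.graph.Dart → ℝ) (mu : I.added.edgeSet → ℝ),
      (∀ v, L v + (∑ d with P.face d = F, c d • Framework.endsLoad p d.edge v +
        I.load mu (.inl v)) = 0) ∧ ∀ j, I.load mu (.inr j) = 0 := by
  obtain ⟨c, mu, h1, h2⟩ := I.resolve hL hsum hoff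
  refine ⟨fun d => if h : P.face d = F then c ⟨d, h⟩ else 0, mu, fun v => ?_, h2⟩
  rw [← h1 v, Finset.sum_subtype (p := fun d => P.face d = F) _ (by simp)]
  congr 2
  exact Finset.sum_congr rfl fun d _ => by simp only [dif_pos d.2]

end BlockFrame

/-! ### Self-stresses of framed holes correspond to motions of the panels. -/

/-- Every self-stress of the polyhedron with framed holes is trivial. -/
def StressFree (p : V → Fin 4 → ℝ) (hole : P.Face → Prop) [Fintype {F // hole F}]
    (I : ∀ F : {F // hole F}, P.BlockFrame p F.1) : Prop :=
  ∀ (w : P.graph.edgeSet → ℝ) (mu : ∀ F : {F // hole F}, (I F).added.edgeSet → ℝ),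
    (∀ v, ∑ e, w e • Framework.endsLoad p e.1 v + ∑ F, (I F).load (mu F) (.inl v) = 0) →
    (∀ F j, (I F).load (mu F) (.inr j) = 0) → w = 0 ∧ ∀ F, mu F = 0

/-- The panel structure whose bodies are the faces that are not holes is rigid. -/
def PanelRigid (P : SphericalPolyhedron V) (p : V → Fin 4 → ℝ) (hole : P.Face → Prop) : Prop :=
  ∀ (S : P.Face → Fin 6 → ℝ) (m : V → Fin 6 → ℝ),
    (∀ d, ¬ hole (P.face d) → ¬ hole (P.face d.symm) →
      ∃ ω : ℝ, S (P.face d) - S (P.face d.symm) = ω • dartJoin p d) →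
    (∀ d, ¬ hole (P.face d) → Through (p d.fst) (S (P.face d) - m d.fst)) →
    (∀ d : P.graph.Dart, ∃ R, Through (p d.fst) (R - m d.fst) ∧ Through (p d.snd) (R - m d.snd)) →
    ∃ T, (∀ F, ¬ hole F → S F = T) ∧ ∀ v, Through (p v) (m v - T)

variable {p : V → Fin 4 → ℝ} {hole : P.Face → Prop} [Fintype {F // hole F}]
  {I : ∀ F : {F // hole F}, P.BlockFrame p F.1}

theorem PanelRigid.stressFree (hp : P.IsConfiguration p) (h : P.PanelRigid p hole) :
    StressFree p hole I := by
  classical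
  intro w mu hw hmu
  set W : {F // hole F} → V → Fin 6 → ℝ := fun F v => (I F).load (mu F) (.inl v) with hW
  have hWoff : ∀ F v, ¬ P.OnFace F.1 v → W F v = 0 := fun F v hv =>
    (I F).load_inl_of_not_onFace _ hv
  have hWsum : ∀ F, ∑ v, W F v = 0 := fun F => (I F).sum_load _ (hmu F)
  have hWthrough : ∀ F v, Through (p v) (W F v) := fun F v => (I F).through_load _ v
  set jump : P.graph.Dart → Fin 6 → ℝ := fun d =>
    ∑ F : {F // hole F}, if P.face d = F.1 then W F d.snd else 0 with hjump
  have hjump_hole : ∀ (F : {F // hole F}) d, P.face d = F.1 → jump d = W F d.snd := by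
    intro F d hd
    simp only [hjump]
    rw [Finset.sum_eq_single F (fun G _ hG => if_neg fun hG' => hG (Subtype.ext (hG'.symm.trans hd)))
      (by simp), if_pos hd]
  have hjump_body : ∀ d, ¬ hole (P.face d) → jump d = 0 := fun d hd =>
    Finset.sum_eq_zero fun F _ => if_neg fun hF => hd (by rw [hF]; exact F.2)
  have hjump_through : ∀ d, Through (p d.snd) (jump d) := fun d => .sum fun F _ => by
    split_ifs
    exacts [hWthrough _ _, .zero _]
  -- Along each face `q` has the prescribed corner changes. In a hole they add up to zero because
  -- the added bars are in equilibrium at the added joints.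
  obtain ⟨q, hq⟩ := exists_sub_eq_of_sum_cycle_eq_zero P.next P.face (fun _ _ => face_eq_iff.symm)
    jump (fun d => by
      by_cases hd : hole (P.face d)
      · rw [← hWsum ⟨_, hd⟩, ← sum_face_snd (hWoff ⟨_, hd⟩)]
        exact Finset.sum_congr rfl fun e he => hjump_hole ⟨_, hd⟩ e (Finset.mem_filter.1 he).2
      · exact Finset.sum_eq_zero fun e he => hjump_body e (by rwa [(Finset.mem_filter.1 he).2]))
  have hjump_sum : ∀ v, ∑ d with d.snd = v, jump d = ∑ F, W F v := by
    intro v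
    simp only [hjump]
    rw [Finset.sum_comm]
    refine Finset.sum_congr rfl fun F _ => ?_
    have h1 := sum_face_snd (F := F.1) (g := fun u => if u = v then W F u else 0) (fun u hu => by
      simp [hWoff F u hu])
    rw [Finset.sum_ite_eq' Finset.univ v (W F), if_pos (Finset.mem_univ v)] at h1
    rw [← h1, Finset.sum_filter, Finset.sum_filter]
    refine Finset.sum_congr rfl fun d _ => ?_
    split_ifs <;> rfl
  -- A face potential corrects `q` so that the changes across edges become the stress terms. Its
  -- vertex condition is exactly the equilibrium of the self-stress.
  obtain ⟨y, hy⟩ := P.exists_face_potential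
    (g := fun d => -w (dartEdge d) • dartJoin p d - (q d - q d.symm)) (fun d => by
      simp only [dartEdge_symm, dartJoin_symm, SimpleGraph.Dart.symm_symm]
      module) (fun v => by
      rw [Finset.sum_sub_distrib, ← sum_snd_next_sub]
      simp only [hq, neg_smul, Finset.sum_neg_distrib]
      rw [hjump_sum, ← sum_smul_endsLoad, ← neg_add', hw, neg_zero])
  set Q : P.graph.Dart → Fin 6 → ℝ := fun d => y (P.face d) + q d with hQ
  have hQsymm : ∀ d, Q d - Q d.symm = -w (dartEdge d) • dartJoin p d := fun d => by
    simp only [hQ]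
    rw [add_sub_add_comm, ← hy]
    abel
  have hQnext : ∀ d, Q (P.next d) - Q d = jump d := fun d => by
    simp only [hQ, face_next]
    rw [add_sub_add_left_eq_sub, hq]
  choose D hD using P.exists_dart
  choose E hE using P.exists_face_eq
  have hQbody : ∀ d, ¬ hole (P.face d) → Q (E (P.face d)) = Q d := fun d hd =>
    eq_of_face_eq (F := P.face d) (fun e he => sub_eq_zero.1 (by
      rw [hQnext, hjump_body _ (he ▸ hd)])) (hE _) rfl
  have hrot : ∀ d, Through (p d.fst) (Q (P.rot d) - Q d) := fun d => by
    have h1 := hQnext (P.rot d).symm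
    rw [next_symm_rot] at h1
    have h2 := hQsymm (P.rot d)
    have h3 := hjump_through (P.rot d).symm
    have h4 := through_fst_dartJoin p (P.rot d)
    have h5 : (P.rot d).symm.snd = d.fst := rot_fst d
    rw [h5, ← h1] at h3
    rw [rot_fst] at h4
    have h6 := h4.smul (-w (dartEdge (P.rot d)))
    rw [← h2] at h6
    exact h6.sub_trans h3.sub_comm
  have hfst : ∀ d, Through (p d.fst) (Q d - Q (D d.fst)) := fun d => through_of_rot hrot (hD _).symm
  have hsnd : ∀ d, Through (p d.snd) (Q d - Q (D d.snd)) := fun d => by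
    have h1 := (through_snd_dartJoin p d).smul (-w (dartEdge d))
    rw [← hQsymm] at h1
    exact h1.sub_trans (hfst d.symm)
  -- All darts at a vertex agree up to screws that fix it, so any of them gives its velocity, and `Q
  -- d` itself is a rigid motion of the edge of `d`.
  obtain ⟨T, hT1, hT2⟩ := h (fun F => Q (E F)) (fun v => Q (D v)) (fun d hd hd' => by
    simp only [hQbody d hd, hQbody d.symm hd', hQsymm]
    exact ⟨_, rfl⟩) (fun d hd => by simp only [hQbody d hd]; exact hfst d)
    (fun d => ⟨Q d, hfst d, hsnd d⟩)
  have hc : ∀ d, ∃ c : ℝ, Q d - T = c • dartJoin p d := fun d =>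
    exists_eq_smul_join (hp _ _ d.adj) ((hfst d).sub_trans (hT2 _)) ((hsnd d).sub_trans (hT2 _))
  choose c hc using hc
  -- Around a hole the load of the added bars at a corner is the change of `c d • dartJoin p d`, so
  -- `-c` on the polygon balances it.
  have hstress : ∀ F : {F // hole F}, (∀ d, P.face d = F.1 → -c d = 0) ∧ mu F = 0 := by
    intro F
    refine (I F).eq_zero_of_polygon_add_load_eq_zero (c := fun d => -c d) (fun v => ?_) (hmu F)
    by_cases hv : P.OnFace F.1 v
    · obtain ⟨d', hd', rfl⟩ := hv
      set d := P.next.symm d' with hd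
      have h1 : P.next d = d' := by simp [hd]
      have h2 : P.face d = F.1 := by rw [← hd', ← h1, face_next]
      rw [← h1, next_fst, sum_face_smul_endsLoad p _ h2]
      change _ + W F d.snd = 0
      rw [← hjump_hole F d h2, ← hQnext, ← sub_sub_sub_cancel_right (Q (P.next d)) (Q d) T, hc, hc]
      module
    · rw [(I F).load_inl_of_not_onFace _ hv, add_zero]
      refine Finset.sum_eq_zero fun d hd => ?_
      rw [BlockFrame.endsLoad_edge_of_not_onFace ⟨d, (Finset.mem_filter.1 hd).2⟩ hv, smul_zero]
  have hQT : ∀ d, Q d = T := fun d => by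
    by_cases hd : hole (P.face d)
    · rw [← sub_eq_zero, hc, neg_eq_zero.1 ((hstress ⟨_, hd⟩).1 d rfl), zero_smul]
    · rw [← hQbody d hd, hT1 _ hd]
  refine ⟨funext fun e => ?_, fun F => (hstress F).2⟩
  obtain ⟨d, rfl⟩ := P.exists_dartEdge_eq e
  have := hQsymm d
  rw [hQT, hQT, sub_self, eq_comm, smul_eq_zero] at this
  exact neg_eq_zero.1 (this.resolve_right (hp.dartJoin_ne_zero d))

theorem StressFree.panelRigid (h : StressFree p hole I) : P.PanelRigid p hole := by
  classical
  intro S m hhinge hface hbar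
  have hface' : ∀ d, ¬ hole (P.face d) → Through (p d.snd) (S (P.face d) - m d.snd) := fun d hd => by
    have := hface (P.next d) (by rwa [face_next])
    rwa [face_next, next_fst] at this
  have hR : ∀ e : P.graph.edgeSet, ∃ R, ∀ d, dartEdge d = e →
      Through (p d.fst) (R - m d.fst) ∧ Through (p d.snd) (R - m d.snd) := fun e => by
    obtain ⟨d, rfl⟩ := P.exists_dartEdge_eq e
    obtain ⟨R, h1, h2⟩ := hbar d
    refine ⟨R, fun d' hd' => ?_⟩
    obtain rfl | rfl := dartEdge_eq_iff.1 hd'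
    exacts [⟨h1, h2⟩, ⟨h2, h1⟩]
  choose R hR using hR
  -- On a side of a hole, `Q` is the screw of the body across the edge, or of the edge as a bar if
  -- there is another hole. Thus `Q` changes only across hinges.
  set Q : P.graph.Dart → Fin 6 → ℝ := fun d => if hole (P.face d) then
    (if hole (P.face d.symm) then R (dartEdge d) else S (P.face d.symm)) else S (P.face d) with hQ
  have hQfst : ∀ d, Through (p d.fst) (Q d - m d.fst) := fun d => by
    simp only [hQ]
    split_ifs with h1 h2
    exacts [(hR _ d rfl).1, hface' d.symm h2, hface d h1]
  have hQsnd : ∀ d, Through (p d.snd) (Q d - m d.snd) := fun d => by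
    simp only [hQ]
    split_ifs with h1 h2
    exacts [(hR _ d rfl).2, hface d.symm h2, hface' d h1]
  have hw : ∀ e : P.graph.edgeSet, ∃ w : ℝ, ∀ d, dartEdge d = e →
      Q d - Q d.symm = w • dartJoin p d := fun e => by
    obtain ⟨d, rfl⟩ := P.exists_dartEdge_eq e
    obtain ⟨w, hw⟩ : ∃ w : ℝ, Q d - Q d.symm = w • dartJoin p d := by
      simp only [hQ, SimpleGraph.Dart.symm_symm, dartEdge_symm]
      by_cases h1 : hole (P.face d) <;> by_cases h2 : hole (P.face d.symm) <;>
        simp only [h1, h2, if_true, if_false]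
      · exact ⟨0, by simp⟩
      · exact ⟨0, by simp⟩
      · exact ⟨0, by simp⟩
      · exact hhinge d h1 h2
    refine ⟨w, fun d' hd' => ?_⟩
    obtain rfl | rfl := dartEdge_eq_iff.1 hd'
    · exact hw
    · rw [SimpleGraph.Dart.symm_symm, dartJoin_symm, smul_neg, ← hw, neg_sub]
  choose w hw using hw
  have hQbody : ∀ d, ¬ hole (P.face d) → Q d = S (P.face d) := fun d hd => if_neg hd
  -- The changes of `Q` at the corners of a hole: a load through the vertices with total zero, since
  -- the changes telescope around the boundary.
  set L : {F // hole F} → V → Fin 6 → ℝ := fun F v =>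
    ∑ d with P.face d = F.1, if d.snd = v then Q (P.next d) - Q d else 0 with hL
  have hLat : ∀ (F : {F // hole F}) d, P.face d = F.1 → L F d.snd = Q (P.next d) - Q d := by
    intro F d hd
    simp only [hL]
    rw [Finset.sum_eq_single d]
    · rw [if_pos rfl]
    · intro e he hne
      refine if_neg fun h => hne (P.next.injective (P.eq_of_face_eq_of_fst_eq
        (by rw [face_next, face_next, hd, (Finset.mem_filter.1 he).2])
        (by rw [next_fst, next_fst, h])))
    · simp [hd]
  have hLsum : ∀ v, ∑ F, L F v = ∑ e, w e • Framework.endsLoad p e.1 v := by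
    intro v
    rw [sum_smul_endsLoad, Finset.sum_congr rfl fun d _ => (hw _ d rfl).symm, ← sum_snd_next_sub]
    simp only [hL, Finset.sum_filter]
    rw [Finset.sum_comm]
    refine Finset.sum_congr rfl fun d _ => ?_
    by_cases hd : hole (P.face d)
    · rw [Finset.sum_eq_single ⟨_, hd⟩ (fun G _ hG => if_neg fun hG' => hG (Subtype.ext hG'.symm))
        (by simp), if_pos rfl]
    · rw [Finset.sum_eq_zero fun F _ => if_neg fun hF => hd (by rw [hF]; exact F.2), hQbody d hd,
        hQbody (P.next d) (by rwa [face_next]), face_next]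
      simp
  have hres : ∀ F : {F // hole F}, ∃ (c : P.graph.Dart → ℝ) (mu : (I F).added.edgeSet → ℝ),
      (∀ v, L F v + (∑ d with P.face d = F.1, c d • Framework.endsLoad p d.edge v +
        (I F).load mu (.inl v)) = 0) ∧ ∀ j, (I F).load mu (.inr j) = 0 := by
    intro F
    refine (I F).exists_polygon_add_load (fun v => .sum fun d _ => ?_) ?_ fun v hv => ?_
    · split_ifs with hd
      · subst hd
        have := hQfst (P.next d)
        rw [next_fst] at this
        exact this.sub_trans (hQsnd d).sub_comm
      · exact .zero _
    · simp only [hL]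
      rw [Finset.sum_comm]
      simp only [Finset.sum_ite_eq, Finset.mem_univ, if_true, Finset.sum_sub_distrib, sum_face_next,
        sub_self]
    · refine Finset.sum_eq_zero fun d hd => if_neg fun h => hv ?_
      rw [← (Finset.mem_filter.1 hd).2, ← h]
      exact onFace_snd d
  choose c mu hc hmu using hres
  set cc : P.graph.Dart → ℝ := fun d => ∑ F : {F // hole F}, if P.face d = F.1 then c F d else 0
    with hcc
  have hcc_hole : ∀ (F : {F // hole F}) d, P.face d = F.1 → cc d = c F d := fun F d hd => by
    simp only [hcc]
    rw [Finset.sum_eq_single F (fun G _ hG => if_neg fun hG' => hG (Subtype.ext (hG'.symm.trans hd)))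
      (by simp), if_pos hd]
  have hcc_body : ∀ d, ¬ hole (P.face d) → cc d = 0 := fun d hd =>
    Finset.sum_eq_zero fun F _ => if_neg fun hF => hd (by rw [hF]; exact F.2)
  have hccsum : ∀ v, ∑ d, cc d • Framework.endsLoad p d.edge v =
      ∑ F : {F // hole F}, ∑ d with P.face d = F.1, c F d • Framework.endsLoad p d.edge v := by
    intro v
    simp only [hcc, Finset.sum_smul, Finset.sum_filter]
    rw [Finset.sum_comm]
    refine Finset.sum_congr rfl fun F _ => Finset.sum_congr rfl fun d _ => ?_
    split_ifs <;> simp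
  -- The hinge coefficients produce the sum of the hole loads at each vertex (`hLsum`), and the
  -- resolutions cancel each of these loads, so together they form a self-stress.
  obtain ⟨hw0, hmu0⟩ := h (fun e => w e + ∑ d with dartEdge d = e, cc d) mu (fun v => by
    simp only [add_smul, Finset.sum_add_distrib]
    rw [sum_smul_endsLoad_fiber, ← hLsum, hccsum, ← Finset.sum_add_distrib,
      ← Finset.sum_add_distrib]
    exact Finset.sum_eq_zero fun F _ => by rw [add_assoc, hc]) hmu
  have hw1 : ∀ d, w (dartEdge d) + (cc d + cc d.symm) = 0 := fun d => by
    rw [← sum_fiber]; exact congrFun hw0 (dartEdge d)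
  -- With `mu = 0`, the boundary polygon alone resolves the corner changes, so adding its terms to
  -- `Q` makes it constant along every face; `hw1` makes it agree across every edge.
  have hconst : ∀ d, Q (P.next d) + cc (P.next d) • dartJoin p (P.next d) =
      Q d + cc d • dartJoin p d := by
    intro d
    by_cases hd : hole (P.face d)
    · have h1 := hc ⟨_, hd⟩ d.snd
      have h2 : (I ⟨_, hd⟩).load (mu ⟨_, hd⟩) (.inl d.snd) = 0 := by
        rw [hmu0]; simp [BlockFrame.load]
      rw [h2, add_zero, hLat _ d rfl, sum_face_smul_endsLoad p _ rfl,
        ← hcc_hole ⟨_, hd⟩ d rfl, ← hcc_hole ⟨_, hd⟩ (P.next d) (face_next d)] at h1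
      rw [← sub_eq_zero, ← h1]
      abel
    · have hd' : ¬ hole (P.face (P.next d)) := by rwa [face_next]
      rw [hcc_body d hd, hcc_body _ hd', hQbody d hd, hQbody _ hd', face_next]
      simp
  choose E hE using P.exists_face_eq
  set y : P.Face → Fin 6 → ℝ := fun F => Q (E F) + cc (E F) • dartJoin p (E F) with hy
  have hyd : ∀ d, y (P.face d) = Q d + cc d • dartJoin p d := fun d =>
    eq_of_face_eq (h := fun d => Q d + cc d • dartJoin p d) (F := P.face d) (fun e _ => hconst e)
      (hE _) rfl
  have hyc := P.eq_of_forall_face (y := y) (fun d => by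
    rw [hyd, hyd, dartJoin_symm, ← sub_eq_zero]
    have h1 := hw _ d rfl
    have h2 : (w (dartEdge d) + (cc d + cc d.symm)) • dartJoin p d = 0 := by rw [hw1, zero_smul]
    rw [add_smul, ← h1] at h2
    rw [← h2]
    module)
  obtain ⟨v⟩ : Nonempty V := Fintype.card_pos_iff.1 (by have := P.four_le; omega)
  obtain ⟨d₀, -⟩ := P.exists_dart v
  refine ⟨y (P.face d₀), fun F hF => ?_, fun v => ?_⟩
  · obtain ⟨d, rfl⟩ := P.exists_face_eq F
    rw [hyc (P.face d₀) (P.face d), hyd, hcc_body d hF, zero_smul, add_zero, hQbody d hF]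
  · obtain ⟨d, rfl⟩ := P.exists_dart v
    rw [hyc (P.face d₀) (P.face d), hyd, ← sub_sub]
    exact (hQfst d).sub_comm.sub ((through_fst_dartJoin p d).smul _)

/-- A polyhedron with a face on a line has a self-stress. -/
theorem StressFree.not_collinearFace (hp : P.IsConfiguration p) (h : StressFree p hole I)
    (F : P.Face) : ¬ P.CollinearFace p F := by
  classical
  intro hF
  obtain ⟨d₀, hd₀⟩ := P.exists_face_eq F
  have hmem : ∀ v, P.OnFace F v → p v ∈ Submodule.span ℝ (p '' {v | P.OnFace F v}) := fun v hv =>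
    Submodule.subset_span ⟨v, hv, rfl⟩
  have hfst : ∀ d, P.face d = F → p d.fst ∈ Submodule.span ℝ (p '' {v | P.OnFace F v}) :=
    fun d hd => hmem _ (hd ▸ onFace_fst d)
  have hsnd : ∀ d, P.face d = F → p d.snd ∈ Submodule.span ℝ (p '' {v | P.OnFace F v}) :=
    fun d hd => hmem _ (hd ▸ onFace_snd d)
  -- On a line all edge extensors are proportional. Scaling them to one common extensor gives a
  -- stress of the boundary cycle in equilibrium at each vertex.
  have ht : ∀ d, ∃ t : ℝ, P.face d = F → t ≠ 0 ∧ t • dartJoin p d = dartJoin p d₀ := by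
    intro d
    by_cases hd : P.face d = F
    · obtain ⟨t, ht⟩ := exists_join_eq_smul_join hF (hfst d₀ hd₀) (hsnd d₀ hd₀) (hfst d hd)
        (hsnd d hd) (hp _ _ d.adj)
      refine ⟨t, fun _ => ⟨?_, ht.symm⟩⟩
      rintro rfl
      exact hp.dartJoin_ne_zero d₀ (by rw [dartJoin, ht, zero_smul])
    · exact ⟨0, fun h => absurd h hd⟩
  choose t ht using ht
  have hsum : ∀ v, ∑ d, (if P.face d = F then t d else 0) • Framework.endsLoad p d.edge v = 0 := by
    intro v
    have h1 : ∀ d, (if P.face d = F then t d else 0) • Framework.endsLoad p d.edge v =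
        if P.face d = F then ((if d.fst = v then dartJoin p d₀ else 0) -
          if (P.next d).fst = v then dartJoin p d₀ else 0) else 0 := by
      intro d
      split_ifs with h1 <;> simp_all [endsLoad_edge, smul_sub, next_fst]
    rw [Finset.sum_congr rfl fun d _ => h1 d, ← Finset.sum_filter, Finset.sum_sub_distrib,
      sum_face_next F (fun d => if d.fst = v then dartJoin p d₀ else 0), sub_self]
  have h0 := (h (fun e => ∑ d with dartEdge d = e, if P.face d = F then t d else 0) 0 (fun v => by
    rw [sum_smul_endsLoad_fiber, hsum]
    simp [BlockFrame.load]) (fun _ _ => by simp [BlockFrame.load])).1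
  have h1 := congrFun h0 (dartEdge d₀)
  simp only [Pi.zero_apply] at h1
  rw [sum_fiber, if_pos hd₀, if_neg (by rw [← hd₀]; exact P.face_symm_ne d₀), add_zero] at h1
  exact (ht d₀ hd₀).1 h1

end SphericalPolyhedron

/-! ### Return to block and hole polyhedra, and separated holes. -/

namespace BlockHolePolyhedron

variable {V : Type*} [Fintype V] {P : BlockHolePolyhedron V} {p : V → Fin 4 → ℝ}

theorem swap_swap (P : BlockHolePolyhedron V) : P.swap.swap = P := by
  obtain ⟨P, kind, h⟩ := P
  have : ∀ k : FaceKind, k.swap.swap = k := fun k => by cases k <;> rfl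
  simp only [swap, this]

theorem swap_kind_eq_hole {F : P.Face} : P.swap.kind F = .hole ↔ P.kind F = .block := by
  change (P.kind F).swap = _ ↔ _
  cases P.kind F <;> simp [FaceKind.swap]

theorem swap_kind_eq_block {F : P.Face} : P.swap.kind F = .block ↔ P.kind F = .hole := by
  change (P.kind F).swap = _ ↔ _
  cases P.kind F <;> simp [FaceKind.swap]

theorem independent_iff_stressFree (I : P.BlockFilling p) :
    (P.staticFramework p I).Independent ↔
      SphericalPolyhedron.StressFree p (fun F => P.kind F = .block) I := by
  constructor
  · intro h w mu h1 h2
    have h3 := h (Sum.elim w fun x => mu x.1 x.2)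
      ((P.staticFramework_isSelfStress_iff I _).2 ⟨h1, h2⟩)
    exact ⟨funext fun e => congrFun h3 (.inl e), fun F => funext fun e => congrFun h3 (.inr ⟨F, e⟩)⟩
  · intro h lam hlam
    obtain ⟨h1, h2⟩ := (P.staticFramework_isSelfStress_iff I _).1 hlam
    obtain ⟨h3, h4⟩ := h _ (fun F e => lam (.inr ⟨F, e⟩)) h1 h2
    funext b
    rcases b with e | ⟨F, e⟩
    exacts [congrFun h3 e, congrFun (h4 F) e]

theorem firstOrderRigid_iff_panelRigid :
    P.FirstOrderRigid p ↔ P.PanelRigid p (fun F => P.swap.kind F = .block) := by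
  simp only [FirstOrderRigid, SphericalPolyhedron.PanelRigid, swap_kind_eq_block]
  constructor
  · intro h S m hhinge hface hbar
    obtain ⟨T, h1, h2⟩ := h (fun F => S F.1) m
      { hinge := by
          rintro d ⟨_, hk⟩ ⟨_, hl⟩ rfl rfl
          obtain ⟨w, hw⟩ := hhinge d hl hk
          refine ⟨-w, ?_⟩
          rw [neg_smul, ← neg_sub, hw]
          rfl
        face_vertex := by
          rintro ⟨F, hF⟩ _ ⟨d, rfl, rfl⟩
          exact hface d hF
        bar := fun u v huv => hbar ⟨(u, v), huv⟩ }
    exact ⟨T, fun F hF => h1 ⟨F, hF⟩, h2⟩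
  · intro h S m hM
    classical
    -- The value at holes is arbitrary, since no condition involves it.
    set S' : P.Face → Fin 6 → ℝ := fun F => if hF : P.kind F = .hole then 0 else S ⟨F, hF⟩
    have hS' : ∀ F (hF : ¬ P.kind F = .hole), S' F = S ⟨F, hF⟩ := fun F hF => dif_neg hF
    obtain ⟨T, h1, h2⟩ := h S' m (fun d hd hd' => by
        obtain ⟨w, hw⟩ := hM.hinge d ⟨_, hd'⟩ ⟨_, hd⟩ rfl rfl
        refine ⟨-w, ?_⟩
        rw [neg_smul, SphericalPolyhedron.dartJoin, ← hw, hS' _ hd, hS' _ hd', neg_sub])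
      (fun d hd => by
        rw [hS' _ hd]
        exact hM.face_vertex ⟨_, hd⟩ _ (SphericalPolyhedron.onFace_fst d))
      (fun d => hM.bar _ _ d.adj)
    exact ⟨T, fun F => by rw [← h1 F.1 F.2, hS' _ F.2], h2⟩

theorem swap_independent_iff_firstOrderRigid (hp : P.IsConfiguration p)
    (I : P.swap.BlockFilling p) :
    (P.swap.staticFramework p I).Independent ↔ P.FirstOrderRigid p := by
  rw [independent_iff_stressFree, firstOrderRigid_iff_panelRigid]
  exact ⟨fun h => h.panelRigid, fun h =>
    SphericalPolyhedron.PanelRigid.stressFree (P := P.swap.toSphericalPolyhedron) hp h⟩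

/-- With at most one hole at `v`, the bodies there form a chain or a full circle of hinges through
`v`, so they all give `v` the same velocity; and each edge borders a body, which moves it rigidly.
-/
theorem FirstOrderRigid.hingeRigid (hsep : P.Separated) (h : P.FirstOrderRigid p) :
    P.HingeRigid p := by
  classical
  intro S hS
  -- The corner where the circuit around `v` starts: that of its hole, or an arbitrary one if there
  -- is none. The next face is then always a body, and its screw serves as the velocity of `v`.
  have hex : ∀ v, ∃ d : P.graph.Dart, d.fst = v ∧
      ∀ e : P.graph.Dart, e.fst = v → P.kind (P.face e) = .hole → e = d := by
    intro v
    by_cases hv : ∃ d : P.graph.Dart, d.fst = v ∧ P.kind (P.face d) = .hole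
    · obtain ⟨d, hd, hk⟩ := hv
      exact ⟨d, hd, fun e he hke => P.eq_of_face_eq_of_fst_eq
        (hsep v _ _ ⟨e, rfl, he⟩ ⟨d, rfl, hd⟩ hke hk) (he.trans hd.symm)⟩
    · obtain ⟨d, hd⟩ := P.exists_dart v
      exact ⟨d, hd, fun e he hke => absurd ⟨e, he, hke⟩ hv⟩
  choose D hD hDhole using hex
  have hrotD : ∀ v, P.kind (P.face (P.rot (D v))) ≠ .hole := fun v hk =>
    P.rot_ne_self _ (hDhole v _ (by rw [SphericalPolyhedron.rot_fst, hD]) hk)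
  set m : V → Fin 6 → ℝ := fun v => S ⟨_, hrotD v⟩ with hm
  have hstep : ∀ (d : P.graph.Dart) (h1 : P.kind (P.face d) ≠ .hole)
      (h2 : P.kind (P.face (P.rot d)) ≠ .hole), Through (p d.fst) (S ⟨_, h1⟩ - S ⟨_, h2⟩) := by
    intro d h1 h2
    obtain ⟨w, hw⟩ := hS (P.rot d) ⟨_, h1⟩ ⟨_, h2⟩ (SphericalPolyhedron.face_symm_rot d) rfl
    rw [hw]
    have := (SphericalPolyhedron.through_fst_dartJoin p (P.rot d)).smul w
    rwa [SphericalPolyhedron.rot_fst] at this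
  have hvert : ∀ (d : P.graph.Dart) (hd : P.kind (P.face d) ≠ .hole),
      Through (p d.fst) (S ⟨_, hd⟩ - m d.fst) := by
    intro d hd
    by_cases hdD : d = D d.fst
    · have h1 : P.kind (P.face (P.rot d)) ≠ .hole := by rw [hdD]; exact hrotD _
      have h2 : m d.fst = S ⟨_, h1⟩ := by
        simp only [hm]; congr; exact hdD.symm
      rw [h2]
      exact hstep d hd h1
    obtain ⟨n, -, -, hn⟩ := ((P.rot_cycle (D d.fst) d).2 (hD _)).exists_pow_eq''
    -- The alternative `D d.fst` allows for the circuit returning to its start, possibly a hole,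
    -- where the comparison begins anew.
    have key : ∀ n : ℕ, ((P.rot ^ n) (D d.fst)).fst = d.fst ∧
        ((P.rot ^ n) (D d.fst) = D d.fst ∨
        ∃ hk : P.kind (P.face ((P.rot ^ n) (D d.fst))) ≠ .hole,
          Through (p d.fst) (S ⟨_, hk⟩ - m d.fst)) := by
      intro n
      induction n with
      | zero => exact ⟨hD _, .inl rfl⟩
      | succ n ih =>
        obtain ⟨ih1, ih2⟩ := ih
        simp only [pow_succ', Equiv.Perm.mul_apply]
        refine ⟨by rw [SphericalPolyhedron.rot_fst, ih1], ?_⟩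
        rcases ih2 with ih2 | ⟨hk, ih2⟩
        · simp only [ih2]
          exact .inr ⟨hrotD _, by simpa [hm] using Through.zero _⟩
        · by_cases h1 : P.kind (P.face (P.rot ((P.rot ^ n) (D d.fst)))) = .hole
          · exact .inl (hDhole _ _ (by rw [SphericalPolyhedron.rot_fst, ih1]) h1)
          · have := hstep _ hk h1
            rw [ih1] at this
            exact .inr ⟨h1, this.sub_comm.sub_trans ih2⟩
    obtain ⟨-, h1 | ⟨hk, h1⟩⟩ := key n
    · exact absurd (hn.symm.trans h1) hdD
    · simp only [hn] at h1
      exact h1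
  have hvert' : ∀ (d : P.graph.Dart) (hd : P.kind (P.face d) ≠ .hole),
      Through (p d.snd) (S ⟨_, hd⟩ - m d.snd) := by
    intro d hd
    have h1 := hvert (P.next d) (by rwa [SphericalPolyhedron.face_next])
    simp only [SphericalPolyhedron.face_next, SphericalPolyhedron.next_fst] at h1
    exact h1
  obtain ⟨T, hT, -⟩ := h S m
    { hinge := hS
      face_vertex := by
        rintro ⟨F, hF⟩ _ ⟨d, rfl, rfl⟩
        exact hvert d hF
      bar := fun u v huv => by
        let d : P.graph.Dart := ⟨(u, v), huv⟩
        by_cases hd : P.kind (P.face d) = .hole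
        · have hd' : P.kind (P.face d.symm) ≠ .hole := fun hd' =>
            P.face_symm_ne d (hsep u _ _ (SphericalPolyhedron.onFace_snd d.symm)
              (SphericalPolyhedron.onFace_fst d) hd' hd)
          exact ⟨S ⟨_, hd'⟩, hvert' d.symm hd', hvert d.symm hd'⟩
        · exact ⟨S ⟨_, hd⟩, hvert d hd, hvert' d hd⟩ }
  exact ⟨T, hT⟩

/-- Two consecutive faces at a vertex are different, so one of them is a body, and it determines the
velocity of the vertex. -/
theorem HingeRigid.firstOrderRigid (hsep : P.Separated) (h : P.HingeRigid p) :
    P.FirstOrderRigid p := by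
  intro S m hM
  obtain ⟨T, hT⟩ := h S hM.hinge
  refine ⟨T, hT, fun v => ?_⟩
  obtain ⟨d, rfl⟩ := P.exists_dart v
  obtain ⟨e, he, hk⟩ : ∃ e : P.graph.Dart, e.fst = d.fst ∧ P.kind (P.face e) ≠ .hole := by
    by_cases hd : P.kind (P.face d) = .hole
    · refine ⟨P.rot d, SphericalPolyhedron.rot_fst d, fun hk => P.rot_ne_self d ?_⟩
      have h1 := SphericalPolyhedron.rot_fst d
      exact P.eq_of_face_eq_of_fst_eq (hsep d.fst _ _ ⟨_, rfl, h1⟩ ⟨_, rfl, rfl⟩ hk hd) h1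
    · exact ⟨d, rfl, hd⟩
  have := hM.face_vertex ⟨_, hk⟩ d.fst ⟨e, rfl, he⟩
  rw [hT] at this
  exact this.sub_comm

/-! ### Virtual work, the symmetric count and the exchange of blocks and holes. -/

/-- A panel motion moves the joints of the bar framework, the added ones with the screw of their
block, and does no work on any bar. Static rigidity gives one screw for all joints, and a body not
on a line must move with it. -/
theorem firstOrderRigid_of_staticallyRigid (hp : P.IsConfiguration p)
    (hF : ∀ F, P.kind F ≠ .hole → ¬ P.CollinearFace p F) (I : P.BlockFilling p)
    (h : (P.staticFramework p I).StaticallyRigid) : P.FirstOrderRigid p := by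
  intro S m hM
  have hb : ∀ F : P.Block, P.kind F.1 ≠ .hole := fun F => by rw [F.2]; simp
  obtain ⟨T, hT⟩ := h.exists_screw _ (by
      rintro (v | ⟨F, j⟩)
      exacts [SphericalPolyhedron.IsConfiguration.ne_zero hp v, (I F).pos_ne_zero j])
    (M := Sum.elim m fun x => S ⟨x.1.1, hb x.1⟩) (by
      rintro (⟨e, he⟩ | ⟨F, e, he⟩)
      · induction e with
        | _ u v =>
          obtain ⟨R, h1, h2⟩ := hM.bar u v he
          exact Framework.sum_screwPairing_endsLoad (i := .inl u) (j := .inl v)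
            (p := (P.staticFramework p I).pos) h1 h2
      · induction e with
        | _ x y =>
          have key : ∀ x : {v : V // P.OnFace F.1 v} ⊕ Fin (I F).n,
              Through ((P.staticFramework p I).pos (Sum.map Subtype.val (fun j => ⟨F, j⟩) x))
                (S ⟨F.1, hb F⟩ - (Sum.elim m fun x => S ⟨x.1.1, hb x.1⟩ :
                  V ⊕ (Σ F : P.Block, Fin (I F).n) → Fin 6 → ℝ)
                  (Sum.map Subtype.val (fun j => ⟨F, j⟩) x)) := by
            rintro (v | j)
            · exact hM.face_vertex ⟨F.1, hb F⟩ v.1 v.2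
            · simpa using Through.zero _
          exact Framework.sum_screwPairing_endsLoad (key x) (key y))
  refine ⟨T, fun F => ?_, fun v => hT (.inl v)⟩
  rw [← sub_eq_zero]
  exact eq_zero_of_forall_through (hF F.1 F.2) fun v hv =>
    (hM.face_vertex F v hv).sub_trans (hT (.inl v))

/-- The number of bars, in terms of the block boundaries and the added vertices. -/
theorem card_bar_add (hp : P.IsConfiguration p)
    (hF : ∀ F, P.kind F = .block → ¬ P.CollinearFace p F) (I : P.BlockFilling p) :
    Fintype.card (P.graph.edgeSet ⊕ (Σ F : P.Block, (I F).added.edgeSet)) + 6 * Fintype.card P.Block =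
      Nat.card P.graph.edgeSet +
      2 * ∑ F : P.Block, Fintype.card {d : P.graph.Dart // P.face d = F.1} +
      3 * ∑ F : P.Block, (I F).n := by
  have h : ∑ F : P.Block, (Fintype.card (I F).added.edgeSet + 6) =
      ∑ F : P.Block, (2 * Fintype.card {d : P.graph.Dart // P.face d = F.1} + 3 * (I F).n) :=
    Finset.sum_congr rfl fun F _ => (I F).card_added_add_six hp (hF F.1 F.2)
  rw [Finset.sum_add_distrib, Finset.sum_add_distrib, ← Finset.mul_sum, ← Finset.mul_sum,
    Finset.sum_const, Finset.card_univ, smul_eq_mul] at h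
  rw [Fintype.card_sum, Fintype.card_sigma, Nat.card_eq_fintype_card]
  omega

theorem sum_kind (f : P.Face → ℕ) : ∑ F, f F =
    ∑ F : P.Block, f F.1 + ∑ F : {F // P.kind F = .hole}, f F.1 +
      ∑ F : {F // P.kind F = .surface}, f F.1 := by
  classical
  have h : ∀ k, ∑ F : {F // P.kind F = k}, f F.1 = ∑ F, if P.kind F = k then f F else 0 := fun k => by
    rw [← Finset.sum_filter, Finset.sum_subtype (p := fun F => P.kind F = k) _ (by simp)]
  rw [h, h, h, ← Finset.sum_add_distrib, ← Finset.sum_add_distrib]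
  refine Finset.sum_congr rfl fun F _ => ?_
  cases P.kind F <;> simp

/-- The count of an isostatic framework, in terms of the blocks and holes. -/
theorem count_iff (hp : P.IsConfiguration p)
    (hF : ∀ F, P.kind F = .block → ¬ P.CollinearFace p F) (I : P.BlockFilling p) :
    Fintype.card (P.graph.edgeSet ⊕ (Σ F : P.Block, (I F).added.edgeSet)) + 6 =
      3 * Fintype.card (V ⊕ (Σ F : P.Block, Fin (I F).n)) ↔
    ∑ F : P.Block, Fintype.card {d : P.graph.Dart // P.face d = F.1} +
        3 * Fintype.card {F // P.kind F = .hole} =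
      ∑ F : {F // P.kind F = .hole}, Fintype.card {d : P.graph.Dart // P.face d = F.1} +
        3 * Fintype.card P.Block := by
  -- Euler's formula and the face lengths, with sum `2|E|`, eliminate `|V|` and `|E|`; the triangles
  -- cancel. What remains is that the sum of (length − 3) is the same over blocks and over holes.
  have h1 := card_bar_add hp hF I
  have h2 := SphericalPolyhedron.sum_card_face P.toSphericalPolyhedron
  have h3 := P.euler
  change Nat.card V + Nat.card P.Face = _ at h3
  have h4 := sum_kind (P := P) fun _ => 1
  simp only [Finset.sum_const, Finset.card_univ, smul_eq_mul, mul_one] at h4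
  rw [Nat.card_eq_fintype_card, Nat.card_eq_fintype_card, h4] at h3
  rw [sum_kind] at h2
  have h5 : ∑ F : {F // P.kind F = .surface}, Fintype.card {d : P.graph.Dart // P.face d = F.1} =
      Fintype.card {F // P.kind F = .surface} * 3 := by
    rw [Finset.sum_congr rfl fun F _ => by
      rw [← Nat.card_eq_fintype_card, P.surface_triangle F.1 F.2], Finset.sum_const,
      Finset.card_univ, smul_eq_mul]
  have h6 : Fintype.card (V ⊕ (Σ F : P.Block, Fin (I F).n)) =
      Fintype.card V + ∑ F : P.Block, (I F).n := by
    rw [Fintype.card_sum, Fintype.card_sigma]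
    simp only [Fintype.card_fin]
  rw [h6]
  rw [h5] at h2
  omega

theorem swap_isostatic (hp : P.IsConfiguration p) (I : P.BlockFilling p) (I' : P.swap.BlockFilling p)
    (h : (P.staticFramework p I).Isostatic) : (P.swap.staticFramework p I').Isostatic := by
  -- Independence keeps every face off a line, the surface triangles included, which the rigidity
  -- argument needs for all bodies.
  have hF : ∀ F, ¬ P.CollinearFace p F := ((independent_iff_stressFree I).1 h.1).not_collinearFace hp
  obtain ⟨v⟩ : Nonempty V := Fintype.card_pos_iff.1 (by have := P.four_le; omega)
  obtain ⟨d, -⟩ := P.exists_dart v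
  have hspan : ∀ T, (∀ v, Through (p v) T) → T = 0 := fun T hT =>
    eq_zero_of_forall_through (hF (P.face d)) fun v _ => hT v
  have hind := (swap_independent_iff_firstOrderRigid hp I').2
    (firstOrderRigid_of_staticallyRigid hp (fun F _ => hF F) I h.2)
  refine hind.isostatic _ ?_ (fun T hT => hspan T fun v => hT (.inl v)) ?_
  · rintro (v | ⟨F, j⟩)
    exacts [SphericalPolyhedron.IsConfiguration.ne_zero hp v, (I' F).pos_ne_zero j]
  · have h1 := (count_iff hp (fun F _ => hF F) I).1 (h.card_add_six _ (by
      rintro (v | ⟨F, j⟩)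
      exacts [SphericalPolyhedron.IsConfiguration.ne_zero hp v, (I F).pos_ne_zero j])
      (fun T hT => hspan T fun v => hT (.inl v)))
    refine (count_iff (P := P.swap) hp (fun F _ => hF F) I').2 ?_
    let e1 : P.swap.Block ≃ {F // P.kind F = .hole} :=
      Equiv.subtypeEquivRight fun F => swap_kind_eq_block
    let e2 : {F // P.swap.kind F = .hole} ≃ P.Block :=
      Equiv.subtypeEquivRight fun F => swap_kind_eq_hole
    have h2 := Equiv.sum_comp e1 fun F => Fintype.card {d : P.graph.Dart // P.face d = F.1}
    have h3 := Equiv.sum_comp e2 fun F => Fintype.card {d : P.graph.Dart // P.face d = F.1}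
    rw [Fintype.card_congr e1, Fintype.card_congr e2]
    exact (congrArg₂ (· + ·) h2 rfl).trans (h1.symm.trans (congrArg₂ (· + ·) h3.symm rfl))

end BlockHolePolyhedron

theorem corollary4p8 {V : Type*} [Fintype V] (P : BlockHolePolyhedron V)
    (p : V → Fin 4 → ℝ) (hp : P.IsConfiguration p) (hgen : P.GeneralPosition p)
    (I : P.BlockFilling p) (I' : P.swap.BlockFilling p) :
    ((P.staticFramework p I).Isostatic ↔ (P.swap.staticFramework p I').Isostatic) ∧
    ((P.swap.staticFramework p I').Independent → P.FirstOrderRigid p) ∧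
    (P.FirstOrderRigid p → (P.swap.staticFramework p I').Independent) ∧
    (P.Separated →
      ((P.swap.staticFramework p I').Independent → P.HingeRigid p) ∧
      (P.HingeRigid p → (P.swap.staticFramework p I').Independent)) := by
  have hiff := BlockHolePolyhedron.swap_independent_iff_firstOrderRigid hp I'
  -- The filling `I` belongs to `P`, not to `P.swap.swap`. Stating the converse for every `Q` equal
  -- to the latter avoids transporting fillings along the equality.
  have hback : ∀ (Q : BlockHolePolyhedron V), P.swap.swap = Q → ∀ J : Q.BlockFilling p,
      (P.swap.staticFramework p I').Isostatic → (Q.staticFramework p J).Isostatic := by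
    rintro _ rfl J
    exact BlockHolePolyhedron.swap_isostatic (P := P.swap) hp I' J
  exact ⟨⟨BlockHolePolyhedron.swap_isostatic hp I I', hback P P.swap_swap I⟩, hiff.1, hiff.2,
    fun hsep => ⟨fun h => (hiff.1 h).hingeRigid hsep, fun h => hiff.2 (h.firstOrderRigid hsep)⟩⟩
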